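/- Let $d\ge 1$, $\alpha\in(0,2)$, $m>2$, $\gamma\in[1,d]$, $K>0$, and let $\mu$ be a finite Borel measure on the unit sphere $\mathbb S\subset\mathbb R^d$ which is nondegenerate (its support is contained in no proper linear subspace of $\mathbb R^d$) and is a $(\gamma-1)$-measure: for some constant $C$, $\mu(\mathbb S\cap B(\theta,\rho))\le C\rho^{\gamma-1}$ for all $\theta\in\mathbb S$, $\rho>0$. Then there are constants $c,c_1,c_2,c_3>0$, depending only on $d,\alpha,m,\gamma,K,\mu$, such that the following holds. Let $Q:\mathbb S\times(0,\infty)\to\mathbb R$ be a Borel function with $K^{-1}f(s)\le Q(\theta,s)\le K f(s)$ for all $\theta\in\mathbb S$, $s>0$, where $f(s)=s^{-\alpha-1}$ for $s\le 1$ and $f(s)=s^{-m-1}$ for $s>1$. Let $b\in\mathbb R^d$, $$\nu(A)=\int_{\mathbb S}\int_0^\infty \mathbf 1_A(s\theta)\,Q(\theta,s)\,ds\,\mu(d\theta),\qquad \Phi(\xi)=-\int\left(e^{i\langle\xi,y\rangle}-1-i\langle\xi,y\rangle\mathbf 1_{B(0,1)}(y)\right)\nu(dy)-i\langle\xi,b\rangle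 .$$ Then there is a convolution semigroup $(P_t)_{t\ge0}$ of probability measures on $\mathbb R^d$ with $\int e^{i\langle\xi,y\rangle}P_t(dy)=e^{-t\Phi(\xi)}$ for all $\xi\in\mathbb R^d$, $t\ge 0$ (the layered stable semigroup, determined by $\Phi$). For every $t>0$ the measure $P_t$ has a continuous density $p_t$ with respect to Lebesgue measure, and, with $$b_r=b-\int_{r<|y|<1}y\,\nu(dy)\ \text{ for } 0<r\le1,\qquad b_r=b+\int_{1<|y|<r}y\,\nu(dy)\ \text{ for } r>1,$$ one has, for $0<t\le1$ and $x\in\mathbb R^d$, $$p_t(x+t\,b_{t^{1/\alpha}})\le c\,t^{-d/\alpha}\min\left\{1,\;t^{1+\gamma/\alpha}|x|^{-\gamma-\alpha}(1+|x|)^{\alpha-m}\right\},$$ and, for $t>1$ and $x\in\mathbb R^d$, $$p_t(x+t\,b_{\sqrt t})\le c_1\,t^{-d/2}\left(\min\left\{1,\;t^{1+\gamma/2}|x|^{-\gamma-\alpha}(1+|x|)^{\alpha-m}\right\}+\exp\left(-\frac{c_2|x|}{\sqrt t}\log\left(1+\frac{c_3|x|}{\sqrt t}\right)\right)\right).$$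 At $x=0$ the minima are read as $1$. -/

import Mathlib

open MeasureTheory
open scoped RealInnerProductSpace ENNReal

/-- A measure on the unit sphere is nondegenerate if its support, as a subset of the whole space,
is contained in no proper linear subspace. -/
def SphereNondegenerate {d : ℕ}
    (μ : Measure (Metric.sphere (0 : EuclideanSpace ℝ (Fin d)) 1)) : Prop :=
  ∀ M : Submodule ℝ (EuclideanSpace ℝ (Fin d)),
    (Subtype.val '' μ.support : Set (EuclideanSpace ℝ (Fin d))) ⊆ M → M = ⊤

/-- `μ` is a `δ`-measure on the unit sphere: `μ (S ∩ B(θ, ρ)) ≤ C ρ ^ δ` for all `θ ∈ S`, `ρ > 0`,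
with some constant `C`. (The ball is taken in the sphere with the Euclidean distance.) -/
def IsSphereDimMeasure {d : ℕ} (δ : ℝ)
    (μ : Measure (Metric.sphere (0 : EuclideanSpace ℝ (Fin d)) 1)) : Prop :=
  ∃ C : ℝ, ∀ (θ : Metric.sphere (0 : EuclideanSpace ℝ (Fin d)) 1) (ρ : ℝ), 0 < ρ →
    μ (Metric.ball θ ρ) ≤ ENNReal.ofReal (C * ρ ^ δ)

/-- The radial profile `s ^ (-α-1)` for `0 < s ≤ 1` and `s ^ (-m-1)` for `s > 1`. -/
noncomputable def layeredProfile (α m s : ℝ) : ℝ :=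
  if s ≤ 1 then s ^ (-α - 1) else s ^ (-m - 1)

/-- `Q(θ, s)` is comparable, with constant `K`, to the layered profile, for all `θ ∈ S`, `s > 0`. -/
def IsLayered {d : ℕ} (α m K : ℝ)
    (Q : Metric.sphere (0 : EuclideanSpace ℝ (Fin d)) 1 → ℝ → ℝ) : Prop :=
  ∀ (θ : Metric.sphere (0 : EuclideanSpace ℝ (Fin d)) 1) (s : ℝ), 0 < s →
    K⁻¹ * layeredProfile α m s ≤ Q θ s ∧ Q θ s ≤ K * layeredProfile α m s

/-- The measure `ν(A) = ∫_S ∫_0^∞ 1_A(s θ) Q(θ, s) ds μ(dθ)`, i.e. the image of the measure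
`Q(θ, s) ds μ(dθ)` on `S × (0, ∞)` under `(θ, s) ↦ s θ`; see `polarMeasure_apply`. -/
noncomputable def polarMeasure {d : ℕ}
    (μ : Measure (Metric.sphere (0 : EuclideanSpace ℝ (Fin d)) 1))
    (Q : Metric.sphere (0 : EuclideanSpace ℝ (Fin d)) 1 → ℝ → ℝ) :
    Measure (EuclideanSpace ℝ (Fin d)) :=
  ((μ.prod (volume.restrict (Set.Ioi (0 : ℝ)))).withDensity
    (fun p => ENNReal.ofReal (Q p.1 p.2))).map
    (fun p => p.2 • (p.1 : EuclideanSpace ℝ (Fin d)))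

theorem polarMeasure_apply {d : ℕ}
    (μ : Measure (Metric.sphere (0 : EuclideanSpace ℝ (Fin d)) 1)) [IsFiniteMeasure μ]
    (Q : Metric.sphere (0 : EuclideanSpace ℝ (Fin d)) 1 → ℝ → ℝ)
    (hQ : Measurable (Function.uncurry Q))
    (A : Set (EuclideanSpace ℝ (Fin d))) (hA : MeasurableSet A) :
    polarMeasure μ Q A = ∫⁻ θ, ∫⁻ s in Set.Ioi (0 : ℝ),
      A.indicator (fun _ => ENNReal.ofReal (Q θ s))
        (s • (θ : EuclideanSpace ℝ (Fin d))) ∂volume ∂μ := by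
  have hm : Measurable (fun p : Metric.sphere (0 : EuclideanSpace ℝ (Fin d)) 1 × ℝ =>
      p.2 • (p.1 : EuclideanSpace ℝ (Fin d))) := by fun_prop
  have hQ' : Measurable (fun p : Metric.sphere (0 : EuclideanSpace ℝ (Fin d)) 1 × ℝ =>
      ENNReal.ofReal (Q p.1 p.2)) := hQ.ennreal_ofReal
  have hS := hm hA
  rw [polarMeasure, Measure.map_apply hm hA, withDensity_apply _ hS, ← lintegral_indicator hS,
    lintegral_prod _ (hQ'.indicator hS).aemeasurable]
  rfl

/-- The characteristic exponent
`Φ(ξ) = -∫ (e^{i⟨ξ,y⟩} - 1 - i⟨ξ,y⟩ 1_{B(0,1)}(y)) ν(dy) - i⟨ξ,b⟩`. -/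
noncomputable def levyExponent {d : ℕ} (ν : Measure (EuclideanSpace ℝ (Fin d)))
    (b ξ : EuclideanSpace ℝ (Fin d)) : ℂ :=
  -(∫ y, (Complex.exp (Complex.I * (⟪ξ, y⟫ : ℝ)) - 1 -
      (Metric.ball (0 : EuclideanSpace ℝ (Fin d)) 1).indicator
        (fun z => Complex.I * ((⟪ξ, z⟫ : ℝ) : ℂ)) y) ∂ν) - Complex.I * (⟪ξ, b⟫ : ℝ)

/-- `(P t)_{t ≥ 0}` is the convolution semigroup of probability measures with
`∫ e^{i⟨ξ,y⟩} P_t(dy) = exp(-t Φ(ξ))`, where `Φ = levyExponent ν b`. -/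
structure IsLevySemigroup {d : ℕ} (ν : Measure (EuclideanSpace ℝ (Fin d)))
    (b : EuclideanSpace ℝ (Fin d)) (P : ℝ → Measure (EuclideanSpace ℝ (Fin d))) : Prop where
  isProbabilityMeasure : ∀ t, 0 ≤ t → IsProbabilityMeasure (P t)
  conv_eq : ∀ s t, 0 ≤ s → 0 ≤ t → (P s).conv (P t) = P (s + t)
  charFun_eq : ∀ t, 0 ≤ t → ∀ ξ, charFun (P t) ξ = Complex.exp (-(t : ℂ) * levyExponent ν b ξ)

/-- `b_r = b - ∫_{r<|y|<1} y ν(dy)` if `r ≤ 1`, and `b_r = b + ∫_{1<|y|<r} y ν(dy)` if `r > 1`. -/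
noncomputable def levyDrift {d : ℕ} (ν : Measure (EuclideanSpace ℝ (Fin d)))
    (b : EuclideanSpace ℝ (Fin d)) (r : ℝ) : EuclideanSpace ℝ (Fin d) :=
  if r ≤ 1 then b - ∫ y in {y | r < ‖y‖ ∧ ‖y‖ < 1}, y ∂ν
  else b + ∫ y in {y | 1 < ‖y‖ ∧ ‖y‖ < r}, y ∂ν

/-- `min {1, t ^ (1 + γ/β) |x| ^ (-γ-α) (1 + |x|) ^ (α-m)}`. At `x = 0` the second term
is `+∞`, so that the minimum is `1`. -/
noncomputable def layeredBound {d : ℕ} (α m γ β t : ℝ) (x : EuclideanSpace ℝ (Fin d)) : ℝ :=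
  if x = 0 then 1
  else min 1 (t ^ (1 + γ / β) * ‖x‖ ^ (-γ - α) * (1 + ‖x‖) ^ (α - m))

/-! Fix t and put r = t^{1/α} for t ≤ 1 and r = √t for t > 1. With l = tν, in both regimes ∫_{|y|<r}
|y|² dl ≲ r², l(|y| ≥ r) ≲ 1 and ∫_{|y|<r} (1 - cos⟨y,ξ⟩) dl ≥ c₀((r|ξ|)^α - 1). The first bound
uses α < 2 near the origin and m > 2 far from it; the last one uses nondegeneracy of μ. Cutting l at
radius r and moving the compensator into the drift (`neg_levyExponent_eq`) presents P_t as the shift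
by t b_r of the convolution of a fully compensated law S with jumps below r and a compound Poisson
law with jumps of size at least r.

Small jumps (`exists_small_jump_density`): Fourier inversion gives S a density s ≲ r^{-d} with
Lipschitz constant ≲ r^{-d-1}. As the jumps are bounded, S has exponential moments, and Chernoff's
bound makes the mass of a ball of radius at most r/2 around x at most a multiple of exp(-v
log(1+v)/4), v = |x|/r. Since s ≥ s(x)/2 on a ball of radius comparable to s(x) r^{d+1}, this bounds
s(x)^{d+1}, hence s(x).

Large jumps (`polarMeasure_ball_inter_le`, `exists_compoundPoisson_le`): a ball of radius ρ at
distance at least R from 0 is seen under an angle of order ρ/R, so the (γ-1)-condition gives it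
ν-mass ≲ ρ^γ R^{-γ-α}(1+R)^{α-m}. This function of R is doubling, so the bound survives convolution:
one summand must have size at least R/2, and the constants for n-fold convolutions grow only like n
D^n, which 1/n! sums. Thus the compound Poisson law is dominated by an atom at 0 plus a measure T
with the same ball bounds.

Averaging s against the atom and T, over shells of width r around x (`exists_density_estimate`),
gives r^{-d} times an exponential term plus r^γ times the ball bound at |x|. For t ≤ 1 the
exponential term is dominated by the polynomial one; for t > 1 it is kept. The semigroup law and the
identification of an arbitrary P_t follow from uniqueness of characteristic functions. -/

set_option linter.unusedSectionVars false

/-! ### Compound Poisson distributions -/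

/-- Convolution powers of a measure. -/
noncomputable def convPow {M : Type*} [AddMonoid M] [MeasurableSpace M] (μ : Measure M) :
    ℕ → Measure M
  | 0 => Measure.dirac 0
  | n + 1 => (convPow μ n).conv μ

instance convPow.instIsFiniteMeasure {M : Type*} [AddMonoid M] [MeasurableSpace M]
    (μ : Measure M) [IsFiniteMeasure μ] (n : ℕ) : IsFiniteMeasure (convPow μ n) := by
  induction n with
  | zero => exact inferInstanceAs (IsFiniteMeasure (Measure.dirac 0))
  | succ n ih => exact inferInstanceAs (IsFiniteMeasure ((convPow μ n).conv μ))

/-- The compound Poisson distribution `e^{-|μ|} ∑ μ^{*n} / n!`. -/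
noncomputable def compoundPoisson {M : Type*} [AddMonoid M] [MeasurableSpace M] (μ : Measure M) :
    Measure M :=
  ENNReal.ofReal (Real.exp (-μ.real Set.univ)) •
    Measure.sum (fun n => ENNReal.ofReal ((n.factorial : ℝ)⁻¹) • convPow μ n)

section

variable {E : Type*} [NormedAddCommGroup E] [InnerProductSpace ℝ E]
  [MeasurableSpace E] [BorelSpace E] [SecondCountableTopology E]

/-- Multiplicative functions turn convolution powers into powers. The choice f = 1 yields total
masses, f = e^{⟨ζ,·⟩} exponential moments. -/
theorem lintegral_convPow {f : E → ℝ≥0∞} (hf : Measurable f) (h0 : f 0 = 1)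
    (hadd : ∀ x y, f (x + y) = f x * f y) (μ : Measure E) [IsFiniteMeasure μ] (n : ℕ) :
    ∫⁻ x, f x ∂convPow μ n = (∫⁻ x, f x ∂μ) ^ n := by
  induction n with
  | zero => simp [convPow, lintegral_dirac' _ hf, h0]
  | succ n ih =>
    rw [convPow, Measure.lintegral_conv hf]
    simp_rw [hadd, lintegral_const_mul _ hf]
    rw [lintegral_mul_const _ hf, ih, pow_succ]

theorem convPow_univ (μ : Measure E) [IsFiniteMeasure μ] (n : ℕ) :
    convPow μ n Set.univ = μ Set.univ ^ n := by
  simpa using lintegral_convPow (f := fun _ => 1) measurable_const rfl (by simp) μ n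

theorem lintegral_compoundPoisson (f : E → ℝ≥0∞) (μ : Measure E) :
    ∫⁻ x, f x ∂compoundPoisson μ = ENNReal.ofReal (Real.exp (-μ.real Set.univ)) *
      ∑' n : ℕ, ENNReal.ofReal ((n.factorial : ℝ)⁻¹) * ∫⁻ x, f x ∂convPow μ n := by
  simp [compoundPoisson, lintegral_sum_measure, lintegral_smul_measure]

theorem tsum_ofReal_inv_factorial_mul_pow {a : ℝ} (ha : 0 ≤ a) :
    ∑' n : ℕ, ENNReal.ofReal ((n.factorial : ℝ)⁻¹) * ENNReal.ofReal a ^ n =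
      ENNReal.ofReal (Real.exp a) := by
  rw [Real.exp_eq_exp_ℝ, NormedSpace.exp_eq_tsum_div,
    ENNReal.ofReal_tsum_of_nonneg (fun n => by positivity) (Real.summable_pow_div_factorial a)]
  congr with n
  rw [← ENNReal.ofReal_pow ha, ← ENNReal.ofReal_mul (by positivity), div_eq_inv_mul]

/-- Integral of a multiplicative function against a compound Poisson distribution. -/
theorem lintegral_compoundPoisson_of_mul {f : E → ℝ≥0∞} (hf : Measurable f) (h0 : f 0 = 1)
    (hadd : ∀ x y, f (x + y) = f x * f y) (μ : Measure E) [IsFiniteMeasure μ] {a : ℝ}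
    (ha : 0 ≤ a) (hfa : ∫⁻ x, f x ∂μ = ENNReal.ofReal a) :
    ∫⁻ x, f x ∂compoundPoisson μ = ENNReal.ofReal (Real.exp (a - μ.real Set.univ)) := by
  simp_rw [lintegral_compoundPoisson, lintegral_convPow hf h0 hadd, hfa]
  rw [tsum_ofReal_inv_factorial_mul_pow ha, ← ENNReal.ofReal_mul (Real.exp_pos _).le,
    ← Real.exp_add, neg_add_eq_sub]

instance compoundPoisson.instIsProbabilityMeasure (μ : Measure E) [IsFiniteMeasure μ] :
    IsProbabilityMeasure (compoundPoisson μ) := by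
  constructor
  have := lintegral_compoundPoisson_of_mul (f := fun _ => 1) measurable_const rfl (by simp) μ
    (a := μ.real Set.univ) measureReal_nonneg (by simp)
  simpa using this

theorem charFun_convPow (μ : Measure E) [IsFiniteMeasure μ] (n : ℕ) (ξ : E) :
    charFun (convPow μ n) ξ = charFun μ ξ ^ n := by
  induction n with
  | zero => simp [convPow]
  | succ n ih => rw [convPow, charFun_conv, ih, pow_succ]

theorem charFun_compoundPoisson (μ : Measure E) [IsFiniteMeasure μ] (ξ : E) :
    charFun (compoundPoisson μ) ξ = Complex.exp (charFun μ ξ - μ.real Set.univ) := by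
  -- Finiteness of the series of measures makes the bounded integrand integrable, so that the
  -- integral may be taken term by term.
  have hfin : IsFiniteMeasure
      (Measure.sum (fun n => ENNReal.ofReal ((n.factorial : ℝ)⁻¹) • convPow μ n)) := by
    constructor
    simp only [Measure.sum_apply _ MeasurableSet.univ, Measure.smul_apply, convPow_univ,
      smul_eq_mul]
    rw [← ofReal_measureReal (μ := μ) (s := Set.univ),
      tsum_ofReal_inv_factorial_mul_pow measureReal_nonneg]
    exact ENNReal.ofReal_lt_top
  have hint : Integrable (fun x => Complex.exp (⟪x, ξ⟫ * Complex.I))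
      (Measure.sum (fun n => ENNReal.ofReal ((n.factorial : ℝ)⁻¹) • convPow μ n)) :=
    (integrable_const (1 : ℝ)).mono (by fun_prop) (by simp)
  rw [charFun_apply, compoundPoisson, integral_smul_measure, integral_sum_measure hint]
  simp_rw [integral_smul_measure, ← charFun_apply, charFun_convPow]
  have hexp : Complex.exp (charFun μ ξ) = ∑' n : ℕ, charFun μ ξ ^ n / (n.factorial : ℂ) := by
    rw [Complex.exp_eq_exp_ℂ, NormedSpace.exp_eq_tsum_div]
  rw [sub_eq_neg_add, Complex.exp_add, hexp, ENNReal.toReal_ofReal (Real.exp_pos _).le,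
    Complex.real_smul]
  push_cast
  congr 2
  ext n
  rw [ENNReal.toReal_ofReal (by positivity), Complex.real_smul]
  push_cast
  field_simp

end

/-! ### Lévy's continuity theorem and infinitely divisible laws with finite second moment -/

section

open Filter Topology

variable {E : Type*} [NormedAddCommGroup E] [InnerProductSpace ℝ E] [FiniteDimensional ℝ E]
  [MeasurableSpace E] [BorelSpace E]

/-- Lévy's continuity theorem: a pointwise limit of characteristic functions which is continuous at
`0` is the characteristic function of the weak limit. -/
theorem exists_tendsto_of_tendsto_charFun {μ : ℕ → ProbabilityMeasure E} {f : E → ℂ}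
    (hf : ContinuousAt f 0) (h : ∀ t, Tendsto (fun n => charFun (μ n : Measure E) t) atTop (𝓝 (f t))) :
    ∃ μ₀ : ProbabilityMeasure E, Tendsto μ atTop (𝓝 μ₀) ∧
      ∀ t, charFun (μ₀ : Measure E) t = f t := by
  have h_tight : IsTightMeasureSet {(μ n : Measure E) | n} :=
    isTightMeasureSet_of_tendsto_charFun (μ := fun n => (μ n : Measure E)) hf h
  have h_compact : IsCompact (closure {μ n | n}) :=
    isCompact_closure_of_isTightMeasureSet (by simpa using h_tight)
  -- Tightness gives a limit along one ultrafilter; its characteristic function must be f, and this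
  -- then forces convergence of the whole sequence.
  obtain ⟨μ', -, hμ'⟩ := h_compact.ultrafilter_le_nhds ((hyperfilter ℕ).map μ)
    (.trans (by simp) (monotone_principal subset_closure))
  have hμ'' : Tendsto μ (hyperfilter ℕ) (𝓝 μ') := hμ'
  have key : ∀ t, charFun (μ' : Measure E) t = f t := by
    intro t
    refine tendsto_nhds_unique ?_ ((h t).mono_left Nat.hyperfilter_le_atTop)
    rw [ProbabilityMeasure.tendsto_iff_forall_integral_rclike_tendsto ℂ] at hμ''
    simp_rw [charFun_eq_integral_innerProbChar]
    exact hμ'' (BoundedContinuousFunction.innerProbChar t)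
  exact ⟨μ', ProbabilityMeasure.tendsto_of_tendsto_charFun (fun t => by rw [key]; exact h t), key⟩

/-- The second-order bound near 0 and the linear growth at infinity are merged into one quadratic
bound, so that a finite second moment of the Lévy measure suffices for integrability. -/
theorem norm_exp_mul_I_sub_one_sub_le (x : ℝ) :
    ‖Complex.exp (x * Complex.I) - 1 - x * Complex.I‖ ≤ 3 * x ^ 2 := by
  have hx : ‖(x : ℂ) * Complex.I‖ = |x| := by simp
  rcases le_total |x| 1 with h | h
  · have := Complex.norm_exp_sub_one_sub_id_le (x := x * Complex.I) (by rw [hx]; exact h)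
    rw [hx, sq_abs] at this
    nlinarith [sq_nonneg x]
  · have h1 : ‖Complex.exp (x * Complex.I) - 1 - x * Complex.I‖ ≤ 1 + 1 + |x| := by
      refine (norm_sub_le _ _).trans ?_
      rw [hx]
      gcongr
      refine (norm_sub_le _ _).trans ?_
      simp [Complex.norm_exp_ofReal_mul_I]
    nlinarith [sq_abs x]

theorem exp_sub_one_sub_le (x : ℝ) : Real.exp x - 1 - x ≤ x ^ 2 * Real.exp |x| := by
  have h := Complex.norm_exp_sub_sum_le_norm_mul_exp (x : ℂ) 2
  simp only [Finset.sum_range_succ, Finset.sum_range_zero, pow_zero, Nat.factorial, pow_one,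
    Complex.norm_real, Real.norm_eq_abs, sq_abs] at h
  norm_num at h
  refine le_trans ?_ h
  rw [show Complex.exp x - (1 + x) = ((Real.exp x - (1 + x) : ℝ) : ℂ) by push_cast; rfl,
    Complex.norm_real]
  exact le_trans (by linarith) (le_abs_self _)

/-- The integrand of a fully compensated Lévy exponent. -/
noncomputable def compensatedExp (ξ y : E) : ℂ :=
  Complex.exp (⟪y, ξ⟫ * Complex.I) - 1 - ⟪y, ξ⟫ * Complex.I

theorem continuous_compensatedExp : Continuous (fun p : E × E => compensatedExp p.1 p.2) := by
  unfold compensatedExp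
  fun_prop

theorem norm_compensatedExp_le (ξ y : E) : ‖compensatedExp ξ y‖ ≤ 3 * ‖ξ‖ ^ 2 * ‖y‖ ^ 2 := by
  refine (norm_exp_mul_I_sub_one_sub_le _).trans ?_
  have := abs_real_inner_le_norm y ξ
  rw [← sq_abs]
  calc 3 * |⟪y, ξ⟫| ^ 2 ≤ 3 * (‖y‖ * ‖ξ‖) ^ 2 := by gcongr
    _ = _ := by ring

variable {l : Measure E}

theorem integrable_compensatedExp (hl : Integrable (fun y => ‖y‖ ^ 2) l) (ξ : E) :
    Integrable (compensatedExp ξ) l := by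
  refine (hl.const_mul (3 * ‖ξ‖ ^ 2)).mono' ?_ (ae_of_all _ fun y => norm_compensatedExp_le ξ y)
  exact (continuous_compensatedExp.comp (by fun_prop : Continuous fun y : E => (ξ, y)))
    |>.aestronglyMeasurable

/-- Dominated convergence; this is the continuity at 0 that Lévy's continuity theorem asks of the
limit. -/
theorem continuousAt_integral_compensatedExp (hl : Integrable (fun y => ‖y‖ ^ 2) l) :
    ContinuousAt (fun ξ => ∫ y, compensatedExp ξ y ∂l) 0 := by
  refine continuousAt_of_dominated (bound := fun y => 3 * ‖y‖ ^ 2) ?_ ?_ (hl.const_mul 3) ?_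
  · exact Eventually.of_forall fun ξ => (integrable_compensatedExp hl ξ).aestronglyMeasurable
  · filter_upwards [Metric.closedBall_mem_nhds (0 : E) one_pos] with ξ hξ
    refine ae_of_all _ fun y => (norm_compensatedExp_le ξ y).trans ?_
    have : ‖ξ‖ ≤ 1 := by simpa using hξ
    calc 3 * ‖ξ‖ ^ 2 * ‖y‖ ^ 2 ≤ 3 * 1 ^ 2 * ‖y‖ ^ 2 := by gcongr
      _ = _ := by ring
  · exact ae_of_all _ fun y => (continuous_compensatedExp.comp
      (by fun_prop : Continuous fun ξ : E => (ξ, y))).continuousAt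

/-- The compensated compound Poisson distribution. -/
noncomputable def compensatedPoisson (l : Measure E) : Measure E :=
  (compoundPoisson l).conv (Measure.dirac (-∫ y, y ∂l))

instance compensatedPoisson.instIsProbabilityMeasure [IsFiniteMeasure l] :
    IsProbabilityMeasure (compensatedPoisson l) :=
  inferInstanceAs (IsProbabilityMeasure ((compoundPoisson l).conv _))

theorem charFun_compensatedPoisson [IsFiniteMeasure l] (hl : Integrable (fun y => y) l) (ξ : E) :
    charFun (compensatedPoisson l) ξ = Complex.exp (∫ y, compensatedExp ξ y ∂l) := by
  have h1 : Integrable (fun x => Complex.exp (⟪x, ξ⟫ * Complex.I)) l :=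
    (integrable_const (1 : ℝ)).mono (by fun_prop) (by simp)
  have h2 : Integrable (fun y => (⟪y, ξ⟫ : ℝ)) l := hl.inner_const ξ
  have h2' : Integrable (fun y => ((⟪y, ξ⟫ : ℝ) : ℂ) * Complex.I) l := h2.ofReal.mul_const _
  rw [compensatedPoisson, charFun_conv, charFun_compoundPoisson, charFun_dirac, ← Complex.exp_add]
  unfold compensatedExp
  congr 1
  have h12 : Integrable (fun y => Complex.exp (⟪y, ξ⟫ * Complex.I) - 1) l :=
    h1.sub (integrable_const _)
  rw [integral_sub h12 h2', integral_sub h1 (integrable_const _),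
    integral_mul_const, integral_complex_ofReal, integral_const, charFun_apply]
  have h3 : ∫ y, (⟪y, ξ⟫ : ℝ) ∂l = ⟪∫ y, y ∂l, ξ⟫ := by
    simp_rw [real_inner_comm ξ]
    exact integral_inner hl ξ
  rw [h3, inner_neg_left]
  simp
  ring

/-- After compensation the log-moment is ∫(e^{⟨ζ,y⟩} - 1 - ⟨ζ,y⟩) dl, of second order in y. The
bound sees l only through its second moment and the bound r on jumps, not through its mass, so it
passes to infinite Lévy measures. -/
theorem lintegral_exp_inner_compensatedPoisson_le [IsFiniteMeasure l] {r : ℝ}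
    (hr : ∀ᵐ y ∂l, ‖y‖ ≤ r) (ζ : E) :
    ∫⁻ x, ENNReal.ofReal (Real.exp ⟪ζ, x⟫) ∂compensatedPoisson l ≤
      ENNReal.ofReal (Real.exp (‖ζ‖ ^ 2 * Real.exp (‖ζ‖ * r) * ∫ y, ‖y‖ ^ 2 ∂l)) := by
  have hmeas : Measurable fun x : E => ENNReal.ofReal (Real.exp ⟪ζ, x⟫) := by fun_prop
  have hbd : ∀ᵐ y ∂l, |(⟪ζ, y⟫ : ℝ)| ≤ ‖ζ‖ * r := by
    filter_upwards [hr] with y hy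
    exact (abs_real_inner_le_norm _ _).trans (by gcongr)
  have hi2 : Integrable (fun y => ‖y‖ ^ 2) l := by
    refine (integrable_const (r ^ 2)).mono' (by fun_prop) ?_
    filter_upwards [hr] with y hy
    rw [Real.norm_eq_abs, abs_of_nonneg (by positivity)]
    gcongr
  have hi1 : Integrable (fun y => y) l := by
    refine (integrable_const r).mono' (by fun_prop) hr
  have hie : Integrable (fun y => Real.exp ⟪ζ, y⟫) l := by
    refine (integrable_const (Real.exp (‖ζ‖ * r))).mono' (by fun_prop) ?_
    filter_upwards [hbd] with y hy
    rw [Real.norm_eq_abs, abs_of_pos (Real.exp_pos _)]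
    exact Real.exp_le_exp.2 ((le_abs_self _).trans hy)
  have hii : Integrable (fun y => (⟪ζ, y⟫ : ℝ)) l := hi1.const_inner ζ
  have hmgf := lintegral_compoundPoisson_of_mul hmeas (by simp)
    (fun x y => by rw [inner_add_right, Real.exp_add, ENNReal.ofReal_mul (Real.exp_pos _).le]) l
    (a := ∫ y, Real.exp ⟪ζ, y⟫ ∂l) (integral_nonneg fun _ => (Real.exp_pos _).le)
    (ofReal_integral_eq_lintegral_ofReal hie (ae_of_all _ fun _ => (Real.exp_pos _).le)).symm
  rw [compensatedPoisson, Measure.lintegral_conv hmeas]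
  simp_rw [lintegral_dirac, inner_add_right, Real.exp_add,
    ENNReal.ofReal_mul (Real.exp_pos _).le]
  rw [lintegral_mul_const _ hmeas, hmgf, ← ENNReal.ofReal_mul (Real.exp_pos _).le, ← Real.exp_add]
  refine ENNReal.ofReal_le_ofReal (Real.exp_le_exp.2 ?_)
  have h3 : ∫ y, (⟪ζ, y⟫ : ℝ) ∂l = ⟪ζ, ∫ y, y ∂l⟫ := integral_inner hi1 ζ
  have h4 : ∫ y, Real.exp ⟪ζ, y⟫ ∂l - l.real Set.univ + ⟪ζ, -∫ y, y ∂l⟫ =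
      ∫ y, (Real.exp ⟪ζ, y⟫ - 1 - ⟪ζ, y⟫) ∂l := by
    have hie1 : Integrable (fun y => Real.exp ⟪ζ, y⟫ - 1) l := hie.sub (integrable_const _)
    rw [integral_sub hie1 hii, integral_sub hie (integrable_const _),
      h3, inner_neg_right]
    simp
    ring
  rw [h4, ← integral_const_mul]
  refine integral_mono_ae ((hie.sub (integrable_const _)).sub hii) (hi2.const_mul _) ?_
  filter_upwards [hbd] with y hy
  refine (exp_sub_one_sub_le _).trans ?_
  calc (⟪ζ, y⟫ : ℝ) ^ 2 * Real.exp |⟪ζ, y⟫| ≤ (‖ζ‖ * ‖y‖) ^ 2 * Real.exp (‖ζ‖ * r) := by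
        rw [← sq_abs]
        gcongr
        exact abs_real_inner_le_norm _ _
    _ = _ := by ring

/-- Existence of the infinitely divisible distribution without Gaussian part whose Lévy measure has
a finite second moment, with exponential moments if the Lévy measure has bounded support. -/
theorem exists_charFun_eq_exp_integral_compensatedExp (hl : Integrable (fun y => ‖y‖ ^ 2) l) :
    ∃ S : Measure E, IsProbabilityMeasure S ∧
      (∀ ξ, charFun S ξ = Complex.exp (∫ y, compensatedExp ξ y ∂l)) ∧
      ∀ r, (∀ᵐ y ∂l, ‖y‖ ≤ r) → ∀ ζ : E, ∫⁻ x, ENNReal.ofReal (Real.exp ⟪ζ, x⟫) ∂S ≤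
        ENNReal.ofReal (Real.exp (‖ζ‖ ^ 2 * Real.exp (‖ζ‖ * r) * ∫ y, ‖y‖ ^ 2 ∂l)) := by
  -- Removing a neighbourhood of the origin leaves a finite measure, by Chebyshev's inequality, to
  -- which the compound Poisson construction applies.
  set s : ℕ → Set E := fun n => {y | 1 / ((n : ℝ) + 1) ≤ ‖y‖} with hs
  have hsm : ∀ n, MeasurableSet (s n) := fun n => measurableSet_le measurable_const measurable_norm
  have hfin : ∀ n, IsFiniteMeasure (l.restrict (s n)) := by
    intro n
    refine ⟨?_⟩
    rw [Measure.restrict_apply_univ]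
    refine lt_of_le_of_lt (measure_mono ?_)
      (hl.measure_norm_ge_lt_top (ε := (1 / ((n : ℝ) + 1)) ^ 2) (by positivity))
    intro y hy
    simp only [Set.mem_ofPred_eq, hs] at hy ⊢
    rw [Real.norm_eq_abs, abs_of_nonneg (by positivity)]
    gcongr
  have hint1 : ∀ n, Integrable (fun y => y) (l.restrict (s n)) := by
    intro n
    refine ((hl.restrict (s := s n)).const_mul ((n : ℝ) + 1)).mono' (by fun_prop) ?_
    refine ae_restrict_of_forall_mem (hsm n) fun y hy => ?_
    simp only [Set.mem_ofPred_eq, hs] at hy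
    rw [div_le_iff₀ (by positivity)] at hy
    nlinarith [norm_nonneg y]
  let μ : ℕ → ProbabilityMeasure E := fun n =>
    ⟨compensatedPoisson (l.restrict (s n)), inferInstance⟩
  have hlim : ∀ ξ, Tendsto (fun n => charFun (μ n : Measure E) ξ) atTop
      (𝓝 (Complex.exp (∫ y, compensatedExp ξ y ∂l))) := by
    intro ξ
    have h1 : ∀ n, charFun (μ n : Measure E) ξ =
        Complex.exp (∫ y in s n, compensatedExp ξ y ∂l) :=
      fun n => charFun_compensatedPoisson (hint1 n) ξ
    simp_rw [h1]
    refine (Complex.continuous_exp.tendsto _).comp ?_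
    have hmono : Monotone s := by
      intro a b hab y hy
      simp only [Set.mem_ofPred_eq, hs] at hy ⊢
      refine le_trans ?_ hy
      gcongr
    have hU : ∫ y in ⋃ n, s n, compensatedExp ξ y ∂l = ∫ y, compensatedExp ξ y ∂l := by
      refine setIntegral_eq_integral_of_forall_compl_eq_zero fun y hy => ?_
      -- The sets exhaust everything but the origin, where the integrand vanishes.
      have : y = 0 := by
        by_contra hne
        obtain ⟨n, hn⟩ := exists_nat_one_div_lt (norm_pos_iff.2 hne)
        exact hy (Set.mem_iUnion.2 ⟨n, hn.le⟩)
      simp [this, compensatedExp]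
    rw [← hU]
    exact tendsto_setIntegral_of_monotone hsm hmono (integrable_compensatedExp hl ξ).integrableOn
  obtain ⟨S, hS, hchar⟩ := exists_tendsto_of_tendsto_charFun
    ((continuousAt_integral_compensatedExp hl).cexp) hlim
  refine ⟨S, inferInstance, hchar, fun r hr ζ => ?_⟩
  -- The exponential is unbounded, so weak convergence gives only a Fatou inequality; an upper bound
  -- is all that is needed.
  have hfatou := lintegral_le_liminf_lintegral_of_forall_isOpen_measure_le_liminf_measure
    (μ := (S : Measure E)) (μs := fun n => (μ n : Measure E)) (f := fun x => Real.exp ⟪ζ, x⟫)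
    (by fun_prop) (fun _ => (Real.exp_pos _).le)
    (fun G hG => ProbabilityMeasure.le_liminf_measure_open_of_tendsto hS hG)
  refine hfatou.trans ?_
  refine liminf_le_of_le (by isBoundedDefault) fun b hb => ?_
  obtain ⟨n, hn⟩ := hb.exists
  refine hn.trans ((lintegral_exp_inner_compensatedPoisson_le
    (ae_restrict_of_ae hr) ζ).trans ?_)
  refine ENNReal.ofReal_le_ofReal (Real.exp_le_exp.2 ?_)
  gcongr
  exact ae_of_all _ fun y => by positivity
  exact Measure.restrict_le_self

end

/-! ### Densities by Fourier inversion -/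

section

open Filter Topology FourierTransform
open scoped ContDiff SchwartzMap

variable {E : Type*} [NormedAddCommGroup E] [InnerProductSpace ℝ E] [FiniteDimensional ℝ E]
  [MeasurableSpace E] [BorelSpace E]

/-- The Fourier transform is moved across the pairing twice, once against Lebesgue measure with F
and once against S with the constant 1; inversion for the Schwartz function g connects the two
identities. -/
theorem integral_schwartz_eq_integral_mul_fourier_charFun (S : Measure E) [IsFiniteMeasure S]
    (hS : Integrable (fun ξ : E => charFun S ((2 * Real.pi) • ξ))) (g : 𝓢(E, ℂ)) :
    ∫ x, g x ∂S = ∫ x, g x * 𝓕 (fun ξ : E => charFun S ((2 * Real.pi) • ξ)) x := by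
  set F : E → ℂ := fun ξ => charFun S ((2 * Real.pi) • ξ) with hF
  have hF' : ∀ ξ, F ξ = VectorFourier.fourierIntegral Real.fourierChar S (innerₗ E) 1 (-ξ) := by
    intro ξ
    rw [hF]
    simp only [charFun_eq_fourierIntegral', smul_smul]
    rw [neg_mul, neg_smul, inv_mul_cancel₀ (by positivity), one_smul]
  have h1 := VectorFourier.integral_fourierIntegral_smul_eq_flip (μ := (volume : Measure E))
    (ν := (volume : Measure E)) (L := innerₗ E) (f := g) (g := F)
    Real.continuous_fourierChar continuous_inner g.integrable hS
  have h2 := VectorFourier.integral_fourierIntegral_smul_eq_flip (μ := S)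
    (ν := (volume : Measure E)) (L := innerₗ E) (f := 1) (g := fun ξ => 𝓕 g (-ξ))
    Real.continuous_fourierChar continuous_inner (integrable_const 1) (𝓕 g).integrable.comp_neg
  rw [flip_innerₗ] at h1 h2
  have h3 : ∀ x, VectorFourier.fourierIntegral Real.fourierChar volume (innerₗ E)
      (fun ξ => 𝓕 g (-ξ)) x = g x := by
    intro x
    have h := congrFun (Real.fourierInv_eq_fourier_comp_neg (𝓕 (g : E → ℂ))) x
    rw [← SchwartzMap.fourier_coe, ← SchwartzMap.fourierInv_coe, FourierPair.fourierInv_fourier_eq] at h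
    exact h.symm
  simp only [h3, Pi.one_apply, one_mul, smul_eq_mul] at h2
  rw [← h2]
  refine Eq.trans ?_ h1
  rw [← integral_neg_eq_self]
  congr with ξ
  rw [hF', mul_comm]
  simp only [neg_neg, smul_eq_mul]
  rfl

/-- A bump function supported where h is negative would have negative integral against h. -/
theorem nonneg_of_forall_integral_contDiff_mul_nonneg {h : E → ℝ} (hc : Continuous h)
    (hg : ∀ g : E → ℝ, ContDiff ℝ ∞ g → HasCompactSupport g → (∀ x, 0 ≤ g x) →
      0 ≤ ∫ x, g x * h x) (x : E) : 0 ≤ h x := by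
  by_contra! hx
  obtain ⟨g, hgs, hgc, hgd, hgr, hgx⟩ := exists_contDiff_tsupport_subset (n := ⊤)
    (hc.continuousAt.eventually_lt continuousAt_const hx : {y | h y < 0} ∈ 𝓝 x)
  have hg0 : ∀ y, 0 ≤ g y := fun y => (hgr ⟨y, rfl⟩).1
  have hpos : 0 < ∫ y, g y * -h y := by
    refine Continuous.integral_pos_of_hasCompactSupport_nonneg_nonzero (x := x)
      (hgd.continuous.mul hc.neg) hgc.mul_right (fun y => ?_) ?_
    · by_cases hy : y ∈ tsupport g
      · exact mul_nonneg (hg0 y) (neg_nonneg.2 (hgs hy).le)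
      · simp [image_eq_zero_of_notMem_tsupport hy]
    · rw [hgx, one_mul]
      exact (neg_pos.2 hx).ne'
  have := hg g hgd hgc hg0
  simp only [mul_neg, integral_neg] at hpos
  linarith

/-- A finite measure with integrable characteristic function has a continuous density, given by
Fourier inversion. -/
theorem exists_density_of_integrable_charFun (S : Measure E) [IsFiniteMeasure S]
    (hS : Integrable (fun ξ : E => charFun S ((2 * Real.pi) • ξ))) :
    ∃ s : E → ℝ, Continuous s ∧ (∀ x, 0 ≤ s x) ∧
      S = volume.withDensity (fun x => ENNReal.ofReal (s x)) ∧
      ∀ x, (s x : ℂ) = 𝓕 (fun ξ : E => charFun S ((2 * Real.pi) • ξ)) x := by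
  set F : E → ℂ := fun ξ => charFun S ((2 * Real.pi) • ξ) with hF
  have hFc : Continuous (𝓕 F) := VectorFourier.fourierIntegral_continuous
    Real.continuous_fourierChar continuous_inner hS
  have key : ∀ g : E → ℝ, ContDiff ℝ ∞ g → HasCompactSupport g →
      ((∫ x, g x ∂S : ℝ) : ℂ) = ∫ x, (g x : ℂ) * 𝓕 F x := by
    intro g hg hgc
    have hgc' : HasCompactSupport (fun x => (g x : ℂ)) := hgc.comp_left (g := Complex.ofReal) rfl
    have hg' : ContDiff ℝ ∞ (fun x => (g x : ℂ)) := Complex.ofRealCLM.contDiff.comp hg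
    rw [← integral_complex_ofReal]
    exact integral_schwartz_eq_integral_mul_fourier_charFun S hS (hgc'.toSchwartzMap hg')
  have hint : ∀ g : E → ℝ, ContDiff ℝ ∞ g → HasCompactSupport g →
      Integrable (fun x => (g x : ℂ) * 𝓕 F x) := fun g hg hgc =>
    Continuous.integrable_of_hasCompactSupport
      ((Complex.continuous_ofReal.comp hg.continuous).mul hFc)
      (HasCompactSupport.mul_right (hgc.comp_left (g := Complex.ofReal) rfl))
  have hre : ∀ g : E → ℝ, ContDiff ℝ ∞ g → HasCompactSupport g →
      ∫ x, g x ∂S = ∫ x, g x * (𝓕 F x).re := by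
    intro g hg hgc
    have h := congrArg Complex.re (key g hg hgc)
    rw [Complex.ofReal_re] at h
    rw [h, ← RCLike.re_eq_complex_re, ← integral_re (hint g hg hgc)]
    simp
  have him : ∀ g : E → ℝ, ContDiff ℝ ∞ g → HasCompactSupport g →
      0 = ∫ x, g x * (𝓕 F x).im := by
    intro g hg hgc
    have h := congrArg Complex.im (key g hg hgc)
    rw [Complex.ofReal_im] at h
    rw [h, ← RCLike.im_eq_complex_im, ← integral_im (hint g hg hgc)]
    simp
  set s : E → ℝ := fun x => (𝓕 F x).re with hs
  have hsc : Continuous s := Complex.continuous_re.comp hFc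
  have hs0 : ∀ x, 0 ≤ s x := nonneg_of_forall_integral_contDiff_mul_nonneg hsc
    fun g hg hgc hg0 => by rw [← hre g hg hgc]; exact integral_nonneg hg0
  -- The imaginary part integrates to zero against every real test function, so it and its negative
  -- are both nonnegative.
  have hi1 : ∀ x, 0 ≤ (𝓕 F x).im := nonneg_of_forall_integral_contDiff_mul_nonneg
    (Complex.continuous_im.comp hFc) fun g hg hgc hg0 => (him g hg hgc).le
  have hi2 : ∀ x, 0 ≤ -(𝓕 F x).im := nonneg_of_forall_integral_contDiff_mul_nonneg
    (Complex.continuous_im.comp hFc).neg fun g hg hgc hg0 => by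
      simp only [mul_neg, integral_neg, ← him g hg hgc, neg_zero, le_refl]
  have hsF : ∀ x, (s x : ℂ) = 𝓕 F x := fun x => by
    apply Complex.ext
    · simp [hs]
    · simpa using le_antisymm (hi1 x) (by linarith [hi2 x])
  -- Bump functions equal to 1 on growing balls bound the integral of s over each ball by the mass
  -- of S.
  have hsi : Integrable s := by
    refine (aecover_closedBall (μ := (volume : Measure E)) (x := (0 : E))
      (tendsto_natCast_atTop_atTop.atTop_add (tendsto_const_nhds (x := (1 : ℝ)))))
      |>.integrable_of_lintegral_enorm_bounded (l := atTop) (S.real Set.univ)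
      hsc.aestronglyMeasurable (Eventually.of_forall fun n => ?_)
    let g : ContDiffBump (0 : E) := ⟨(n : ℝ) + 1, (n : ℝ) + 2, by positivity, by linarith⟩
    have hgi : Integrable (fun x => g x * s x) :=
      (g.continuous.mul hsc).integrable_of_hasCompactSupport g.hasCompactSupport.mul_right
    have hg01 : ∀ x, 0 ≤ g x * s x := fun x => mul_nonneg g.nonneg (hs0 x)
    calc ∫⁻ x in Metric.closedBall 0 ((n : ℝ) + 1), ‖s x‖ₑ
        = ∫⁻ x in Metric.closedBall 0 ((n : ℝ) + 1), ENNReal.ofReal (g x * s x) := by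
          refine setLIntegral_congr_fun measurableSet_closedBall fun x hx => ?_
          simp only [g.one_of_mem_closedBall hx, one_mul, Real.enorm_eq_ofReal (hs0 x)]
      _ ≤ ∫⁻ x, ENNReal.ofReal (g x * s x) := setLIntegral_le_lintegral _ _
      _ = ENNReal.ofReal (∫ x, g x * s x) :=
          (ofReal_integral_eq_lintegral_ofReal hgi (ae_of_all _ hg01)).symm
      _ ≤ ENNReal.ofReal (S.real Set.univ) := by
          refine ENNReal.ofReal_le_ofReal ?_
          rw [← hre g g.contDiff g.hasCompactSupport]
          calc ∫ x, g x ∂S ≤ ∫ x, (1 : ℝ) ∂S := by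
                refine integral_mono ?_ (integrable_const _) fun x => g.le_one
                exact (integrable_const (1 : ℝ)).mono' g.continuous.aestronglyMeasurable
                  (ae_of_all _ fun x => by
                    rw [Real.norm_eq_abs, abs_of_nonneg g.nonneg]; exact g.le_one)
            _ = S.real Set.univ := by simp
  have hfin : IsFiniteMeasure (volume.withDensity (fun x => ENNReal.ofReal (s x))) :=
    isFiniteMeasure_withDensity_ofReal hsi.2
  refine ⟨s, hsc, hs0, ?_, hsF⟩
  refine Measure.ext_of_charFun (funext fun t => ?_)
  -- Both F and its transform are now integrable, so inversion applies and S and the measure with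
  -- density s have the same characteristic function.
  have hinv : 𝓕⁻ (𝓕 F) = F := Continuous.fourierInv_fourier_eq
    (by rw [hF]; fun_prop) hS ((hsi.ofReal (𝕜 := ℂ)).congr (ae_of_all _ hsF))
  have ht : charFun S t = F ((2 * Real.pi)⁻¹ • t) := by
    simp only [hF, smul_smul]
    rw [mul_inv_cancel₀ (by positivity), one_smul]
  rw [ht, ← hinv, Real.fourierInv_eq', charFun_apply,
    integral_withDensity_eq_integral_toReal_smul₀ (by fun_prop) (by simp)]
  congr with x
  rw [ENNReal.toReal_ofReal (hs0 x), Complex.real_smul, hsF, real_inner_smul_right,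
    smul_eq_mul, mul_comm]
  congr 3
  push_cast
  field_simp

theorem integrable_and_integral_comp_smul_eq {f : E → ℝ} (hf : Integrable f) {r : ℝ}
    (hr : 0 < r) : Integrable (fun x => f (r • x)) ∧
      ∫ x, f (r • x) = (r ^ Module.finrank ℝ E)⁻¹ * ∫ x, f x := by
  refine ⟨hf.comp_smul hr.ne', ?_⟩
  rw [Measure.integral_comp_smul, smul_eq_mul, abs_of_nonneg (by positivity)]

/-- A probability measure whose characteristic function decays at scale `1 / r` has a density,
with a bound and a Lipschitz constant. -/
theorem exists_density_lipschitz (E : Type*) [NormedAddCommGroup E] [InnerProductSpace ℝ E]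
    [FiniteDimensional ℝ E] [MeasurableSpace E] [BorelSpace E] :
    ∃ B : ℝ, 0 < B ∧ ∀ (S : Measure E) [IsFiniteMeasure S] (C r : ℝ), 0 < C → 0 < r →
      (∀ ξ, ‖charFun S ((2 * Real.pi) • ξ)‖ ≤
        C * (1 + r * ‖ξ‖) ^ (-((Module.finrank ℝ E : ℝ) + 2))) →
      ∃ s : E → ℝ, Continuous s ∧ (∀ x, 0 ≤ s x) ∧
        S = volume.withDensity (fun x => ENNReal.ofReal (s x)) ∧
        (∀ x, s x ≤ B * C * (r ^ Module.finrank ℝ E)⁻¹) ∧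
        ∀ x y, s x - s y ≤ B * C * (r ^ Module.finrank ℝ E)⁻¹ * r⁻¹ * ‖x - y‖ := by
  set d : ℕ := Module.finrank ℝ E with hd
  -- The exponent d + 2 leaves ‖ξ‖F(ξ) with decay of order d + 1, still integrable; the integral of
  -- F bounds the density and that of 2π‖ξ‖F its Lipschitz constant.
  set J2 : E → ℝ := fun x => (1 + ‖x‖) ^ (-((d : ℝ) + 2)) with hJ2d
  set J1 : E → ℝ := fun x => (1 + ‖x‖) ^ (-((d : ℝ) + 1)) with hJ1d
  have hJ2 : Integrable J2 := integrable_one_add_norm (by linarith)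
  have hJ1 : Integrable J1 := integrable_one_add_norm (by linarith)
  have hJ2n : 0 ≤ ∫ x, J2 x := integral_nonneg fun x => by positivity
  have hJ1n : 0 ≤ ∫ x, J1 x := integral_nonneg fun x => by positivity
  refine ⟨(∫ x, J2 x) + 2 * Real.pi * (∫ x, J1 x) + 1, by positivity, ?_⟩
  intro S _ C r hC hr hb
  set F : E → ℂ := fun ξ => charFun S ((2 * Real.pi) • ξ) with hF
  obtain ⟨hi2, he2⟩ := integrable_and_integral_comp_smul_eq hJ2 hr
  obtain ⟨hi1, he1⟩ := integrable_and_integral_comp_smul_eq hJ1 hr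
  have hb2 : ∀ ξ, ‖F ξ‖ ≤ C * J2 (r • ξ) := fun ξ => by
    simpa only [hJ2d, norm_smul, Real.norm_eq_abs, abs_of_pos hr] using hb ξ
  have hFm : AEStronglyMeasurable F volume := by
    rw [hF]; exact Continuous.aestronglyMeasurable (by fun_prop)
  have hFi : Integrable F := (hi2.const_mul C).mono' hFm (ae_of_all _ hb2)
  have hb1 : ∀ ξ, ‖ξ‖ * ‖F ξ‖ ≤ r⁻¹ * (C * J1 (r • ξ)) := fun ξ => by
    have hrx : ‖r • ξ‖ = r * ‖ξ‖ := by rw [norm_smul, Real.norm_eq_abs, abs_of_pos hr]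
    have h1 : ‖r • ξ‖ * J2 (r • ξ) ≤ J1 (r • ξ) := by
      have h0 : 0 < 1 + ‖r • ξ‖ := by positivity
      have : J1 (r • ξ) = (1 + ‖r • ξ‖) * J2 (r • ξ) := by
        simp only [hJ1d, hJ2d]
        rw [← Real.rpow_one_add' h0.le (by linarith [Nat.cast_nonneg (α := ℝ) d])]
        congr 1
        ring
      rw [this]
      gcongr
      linarith
    calc ‖ξ‖ * ‖F ξ‖ ≤ ‖ξ‖ * (C * J2 (r • ξ)) := by gcongr; exact hb2 ξ
      _ = r⁻¹ * (C * (‖r • ξ‖ * J2 (r • ξ))) := by rw [hrx]; field_simp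
      _ ≤ _ := by gcongr
  obtain ⟨s, hsc, hs0, hsd, hsF⟩ := exists_density_of_integrable_charFun S hFi
  refine ⟨s, hsc, hs0, hsd, fun x => ?_, fun x y => ?_⟩
  · have h1 : s x ≤ ‖𝓕 F x‖ := by
      rw [← hsF, Complex.norm_real]; exact le_abs_self _
    have h2 : ‖𝓕 F x‖ ≤ ∫ ξ, ‖F ξ‖ := VectorFourier.norm_fourierIntegral_le_integral_norm _ _ _ _ _
    have h3 : ∫ ξ, ‖F ξ‖ ≤ ∫ ξ, C * J2 (r • ξ) :=
      integral_mono hFi.norm (hi2.const_mul C) hb2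
    rw [integral_const_mul, he2] at h3
    calc s x ≤ C * ((r ^ d)⁻¹ * ∫ x, J2 x) := h1.trans (h2.trans h3)
      _ = (∫ x, J2 x) * C * (r ^ d)⁻¹ := by ring
      _ ≤ _ := by
        gcongr
        nlinarith [Real.pi_pos]
  · have h1 : s x - s y ≤ ‖𝓕 F x - 𝓕 F y‖ := by
      rw [← hsF, ← hsF, ← Complex.ofReal_sub, Complex.norm_real]; exact le_abs_self _
    have hint : ∀ z, Integrable (fun v : E =>
        Complex.exp (↑(-2 * Real.pi * ⟪v, z⟫) * Complex.I) • F v) := fun z =>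
      hFi.norm.mono' (by fun_prop) (ae_of_all _ fun v => by
        rw [norm_smul, Complex.norm_exp_ofReal_mul_I, one_mul])
    have h2 : ‖𝓕 F x - 𝓕 F y‖ ≤
        ∫ v, 2 * Real.pi * ‖x - y‖ * (r⁻¹ * (C * J1 (r • v))) := by
      rw [Real.fourier_eq', Real.fourier_eq', ← integral_sub (hint x) (hint y)]
      refine norm_integral_le_of_norm_le (((hi1.const_mul C).const_mul _).const_mul _)
        (ae_of_all _ fun v => ?_)
      rw [← sub_smul, norm_smul]
      have h3 : ‖Complex.exp (↑(-2 * Real.pi * ⟪v, x⟫) * Complex.I) -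
          Complex.exp (↑(-2 * Real.pi * ⟪v, y⟫) * Complex.I)‖ ≤
          2 * Real.pi * (‖v‖ * ‖x - y‖) := by
        have h4 : Complex.exp (↑(-2 * Real.pi * ⟪v, x⟫) * Complex.I) =
            Complex.exp (↑(-2 * Real.pi * ⟪v, y⟫) * Complex.I) *
              Complex.exp (Complex.I * ↑(-2 * Real.pi * ⟪v, x - y⟫)) := by
          rw [← Complex.exp_add, inner_sub_right]
          congr 1
          push_cast
          ring
        rw [h4, ← mul_sub_one, norm_mul, Complex.norm_exp_ofReal_mul_I, one_mul]
        refine Real.norm_exp_I_mul_ofReal_sub_one_le.trans ?_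
        rw [Real.norm_eq_abs, abs_mul, abs_mul, abs_neg, abs_two, abs_of_pos Real.pi_pos]
        gcongr
        exact abs_real_inner_le_norm _ _
      calc _ ≤ 2 * Real.pi * (‖v‖ * ‖x - y‖) * ‖F v‖ := by gcongr
        _ = 2 * Real.pi * ‖x - y‖ * (‖v‖ * ‖F v‖) := by ring
        _ ≤ _ := mul_le_mul_of_nonneg_left (hb1 v) (by positivity)
    rw [integral_const_mul, integral_const_mul, integral_const_mul, he1] at h2
    calc s x - s y ≤ _ := h1.trans h2
      _ = 2 * Real.pi * (∫ x, J1 x) * C * (r ^ d)⁻¹ * r⁻¹ * ‖x - y‖ := by ring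
      _ ≤ _ := by
        gcongr
        linarith

end

/-! ### The law of the small jumps: Chernoff's bound and a pointwise density bound -/

section

/-- For u ≥ 1 a single term (c u^α)^k / k! of the exponential series, with kα ≥ N, already beats the
power. -/
theorem exists_exp_neg_rpow_le {α c N : ℝ} (hα : 0 < α) (hc : 0 < c) (hN : 0 ≤ N) :
    ∃ C : ℝ, 0 < C ∧ ∀ u : ℝ, 0 ≤ u → Real.exp (-(c * u ^ α)) ≤ C * (1 + u) ^ (-N) := by
  obtain ⟨k, hk⟩ := exists_nat_ge (N / α)
  rw [div_le_iff₀ hα] at hk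
  refine ⟨2 ^ N * (1 + k.factorial / c ^ k), by positivity, fun u hu => ?_⟩
  have h1u : 0 < 1 + u := by linarith
  rw [Real.rpow_neg h1u.le, ← div_eq_mul_inv, le_div_iff₀ (by positivity)]
  have hexp1 : Real.exp (-(c * u ^ α)) ≤ 1 := by
    rw [Real.exp_le_one_iff]
    have : 0 ≤ c * u ^ α := by positivity
    linarith
  have hf : 0 ≤ (k.factorial : ℝ) / c ^ k := by positivity
  rcases le_total u 1 with h | h
  · calc Real.exp (-(c * u ^ α)) * (1 + u) ^ N ≤ 1 * 2 ^ N := by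
          gcongr
          linarith
      _ ≤ _ := by nlinarith [Real.rpow_pos_of_pos (two_pos (α := ℝ)) N]
  · have hu0 : 0 < u := by linarith
    have h2 : (1 + u) ^ N ≤ 2 ^ N * u ^ N := by
      rw [← Real.mul_rpow (by norm_num) hu]
      gcongr
      linarith
    have h3 : u ^ N ≤ (u ^ α) ^ k := by
      rw [← Real.rpow_natCast, ← Real.rpow_mul hu]
      exact Real.rpow_le_rpow_of_exponent_le h (by linarith)
    have h4 := Real.pow_div_factorial_le_exp (c * u ^ α) (by positivity) k
    rw [mul_pow, div_le_iff₀ (by positivity)] at h4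
    have h5 : (u ^ α) ^ k ≤ Real.exp (c * u ^ α) * (k.factorial / c ^ k) := by
      rw [← mul_div_assoc, le_div_iff₀ (by positivity)]
      linarith
    calc Real.exp (-(c * u ^ α)) * (1 + u) ^ N
        ≤ Real.exp (-(c * u ^ α)) *
          (2 ^ N * (Real.exp (c * u ^ α) * (k.factorial / c ^ k))) := by
          gcongr
          exact h2.trans (by gcongr; exact h3.trans h5)
      _ = (Real.exp (-(c * u ^ α)) * Real.exp (c * u ^ α)) *
          (2 ^ N * (k.factorial / c ^ k)) := by ring
      _ = 2 ^ N * (k.factorial / c ^ k) := by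
          rw [← Real.exp_add, neg_add_cancel, Real.exp_zero, one_mul]
      _ ≤ _ := by
          gcongr
          linarith

/-- Optimization of the exponent in Chernoff's bound. -/
theorem exists_chernoff_exponent {A : ℝ} (hA : 0 ≤ A) :
    ∃ C : ℝ, ∀ v : ℝ, 0 ≤ v → ∃ k : ℝ, 0 ≤ k ∧
      A * (k ^ 2 * Real.exp k) + k / 2 - k * v ≤ C - v * Real.log (1 + v) / 4 := by
  refine ⟨(2 * A + 1) * (1 + Real.exp (4 * (2 * A + 1))), fun v hv => ?_⟩
  have hlog : 0 ≤ Real.log (1 + v) := Real.log_nonneg (by linarith)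
  -- With e^k = √(1+v) the cost A k² e^k + k/2 is at most linear in v, while the gain is kv = v
  -- log(1+v)/2. Half of the gain absorbs the linear cost once log(1+v) ≥ 4(2A+1); smaller v are
  -- paid for by the constant.
  refine ⟨Real.log (1 + v) / 2, by linarith, ?_⟩
  set k := Real.log (1 + v) / 2 with hk
  have hk0 : 0 ≤ k := by rw [hk]; linarith
  have he : Real.exp k * Real.exp k = 1 + v := by
    rw [← Real.exp_add, hk, add_halves, Real.exp_log (by linarith)]
  have h1 : k ^ 2 ≤ 2 * Real.exp k := by
    have := Real.quadratic_le_exp_of_nonneg hk0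
    nlinarith
  have h2 : k ≤ Real.exp k := by linarith [Real.add_one_le_exp k]
  have h3 : 1 ≤ Real.exp k := Real.one_le_exp hk0
  have h4 : A * (k ^ 2 * Real.exp k) ≤ 2 * A * (1 + v) := by
    calc A * (k ^ 2 * Real.exp k) ≤ A * (2 * Real.exp k * Real.exp k) := by gcongr
      _ = 2 * A * (1 + v) := by rw [mul_assoc 2, he]; ring
  have h5 : k / 2 ≤ 1 + v := by nlinarith
  have h6 : (2 * A + 1) * v ≤
      v * Real.log (1 + v) / 4 + (2 * A + 1) * Real.exp (4 * (2 * A + 1)) := by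
    rcases le_total v (Real.exp (4 * (2 * A + 1))) with h | h
    · have : 0 ≤ v * Real.log (1 + v) := by positivity
      nlinarith
    · have : 4 * (2 * A + 1) ≤ Real.log (1 + v) := by
        rw [Real.le_log_iff_exp_le (by linarith)]
        linarith
      nlinarith [Real.exp_pos (4 * (2 * A + 1))]
  have h7 : k * v = v * Real.log (1 + v) / 2 := by rw [hk]; ring
  nlinarith

variable {E : Type*} [NormedAddCommGroup E] [InnerProductSpace ℝ E] [FiniteDimensional ℝ E]
  [MeasurableSpace E] [BorelSpace E]

theorem norm_exp_integral_compensatedExp {l : Measure E}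
    (hl : Integrable (fun y => ‖y‖ ^ 2) l) (ξ : E) :
    ‖Complex.exp (∫ y, compensatedExp ξ y ∂l)‖ =
      Real.exp (-∫ y, (1 - Real.cos ⟪y, ξ⟫) ∂l) := by
  rw [Complex.norm_exp, ← RCLike.re_eq_complex_re, ← integral_re (integrable_compensatedExp hl ξ),
    ← integral_neg]
  congr 2 with y
  simp [compensatedExp, Complex.exp_ofReal_mul_I_re]

/-- Chernoff's bound for balls. -/
theorem exp_mul_measure_ball_le (S : Measure E) (ζ x : E) (ρ : ℝ) :
    ENNReal.ofReal (Real.exp (⟪ζ, x⟫ - ‖ζ‖ * ρ)) * S (Metric.ball x ρ) ≤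
      ∫⁻ y, ENNReal.ofReal (Real.exp ⟪ζ, y⟫) ∂S := by
  rw [← setLIntegral_const]
  refine (setLIntegral_mono (by fun_prop) fun y hy => ?_).trans (setLIntegral_le_lintegral _ _)
  refine ENNReal.ofReal_le_ofReal (Real.exp_le_exp.2 ?_)
  have h1 : ⟪ζ, x - y⟫ ≤ ‖ζ‖ * ‖x - y‖ := real_inner_le_norm _ _
  have h2 : ‖x - y‖ ≤ ρ := by
    rw [← dist_eq_norm, dist_comm]; exact (Metric.mem_ball.1 hy).le
  rw [inner_sub_right] at h1
  nlinarith [norm_nonneg ζ]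

/-- A value of a Lipschitz density is controlled by the mass of a small ball. -/
theorem lipschitz_density_pow_le {S : Measure E} {s : E → ℝ}
    (hs : S = volume.withDensity (fun x => ENNReal.ofReal (s x))) {Λ : ℝ} (hΛ : 0 < Λ)
    (hL : ∀ x y, s x - s y ≤ Λ * ‖x - y‖) {x : E} (hx : 0 < s x) {b : ℝ} (hb : 0 ≤ b)
    (hball : S (Metric.ball x (s x / (2 * Λ))) ≤ ENNReal.ofReal b) :
    s x / 2 * ((s x / (2 * Λ)) ^ Module.finrank ℝ E * volume.real (Metric.ball (0 : E) 1)) ≤ b := by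
  set ρ := s x / (2 * Λ) with hρ
  have hρ0 : 0 < ρ := by positivity
  rw [← ENNReal.ofReal_le_ofReal_iff hb]
  refine le_trans ?_ hball
  rw [hs, withDensity_apply _ measurableSet_ball]
  -- On this ball the Lipschitz bound lets s drop by at most s(x)/2.
  calc ENNReal.ofReal (s x / 2 * (ρ ^ Module.finrank ℝ E * volume.real (Metric.ball (0 : E) 1)))
      = ∫⁻ y in Metric.ball x ρ, ENNReal.ofReal (s x / 2) := by
        rw [setLIntegral_const, Measure.addHaar_ball_of_pos _ _ hρ0, ENNReal.ofReal_mul (by positivity),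
          ENNReal.ofReal_mul (by positivity), ofReal_measureReal measure_ball_lt_top.ne]
    _ ≤ _ := by
        refine setLIntegral_mono' measurableSet_ball fun y hy => ENNReal.ofReal_le_ofReal ?_
        have h1 := hL x y
        have h2 : ‖x - y‖ ≤ ρ := by
          rw [← dist_eq_norm, dist_comm]; exact (Metric.mem_ball.1 hy).le
        have h3 : Λ * ‖x - y‖ ≤ Λ * ρ := by gcongr
        have h4 : Λ * ρ = s x / 2 := by rw [hρ]; field_simp
        linarith

/-- Density estimate for an infinitely divisible distribution whose Lévy measure is supported in
the ball of radius `r`. -/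
theorem exists_small_jump_density (E : Type*) [NormedAddCommGroup E] [InnerProductSpace ℝ E]
    [FiniteDimensional ℝ E] [MeasurableSpace E] [BorelSpace E] {α c₀ A : ℝ} (hα : 0 < α)
    (hc₀ : 0 < c₀) (hA : 0 ≤ A) :
    ∃ B c : ℝ, 0 < B ∧ 0 < c ∧ ∀ (l : Measure E) (r : ℝ), 0 < r → (∀ᵐ y ∂l, ‖y‖ ≤ r) →
      Integrable (fun y => ‖y‖ ^ 2) l → ∫ y, ‖y‖ ^ 2 ∂l ≤ A * r ^ 2 →
      (∀ ξ, c₀ * ((r * ‖ξ‖) ^ α - 1) ≤ ∫ y, (1 - Real.cos ⟪y, ξ⟫) ∂l) →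
      ∃ (S : Measure E) (s : E → ℝ), IsProbabilityMeasure S ∧
        (∀ ξ, charFun S ξ = Complex.exp (∫ y, compensatedExp ξ y ∂l)) ∧
        Continuous s ∧ (∀ x, 0 ≤ s x) ∧
        S = volume.withDensity (fun x => ENNReal.ofReal (s x)) ∧
        (∀ x, s x ≤ B * (r ^ Module.finrank ℝ E)⁻¹) ∧
        ∀ x, s x ≤ B * (r ^ Module.finrank ℝ E)⁻¹ *
          Real.exp (-c * (‖x‖ / r) * Real.log (1 + ‖x‖ / r)) := by
  set d : ℕ := Module.finrank ℝ E with hd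
  obtain ⟨B, hB, hdens⟩ := exists_density_lipschitz E
  obtain ⟨C, hC, hCb⟩ := exists_exp_neg_rpow_le (N := (d : ℝ) + 2) hα hc₀ (by positivity)
  obtain ⟨D, hD⟩ := exists_chernoff_exponent hA
  set B₁ : ℝ := B * (Real.exp c₀ * C) with hB₁
  have hB₁0 : 0 < B₁ := by positivity
  set κ : ℝ := volume.real (Metric.ball (0 : E) 1) with hκ
  have hκ0 : 0 < κ := by
    rw [hκ, measureReal_def]
    exact ENNReal.toReal_pos (Metric.measure_ball_pos _ _ one_pos).ne' measure_ball_lt_top.ne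
  -- Chosen so that the lower bound for the mass of the ball of radius ρ = s(x)/(2Λ) reads (s(x)
  -- r^d)^{d+1} / M.
  set M : ℝ := 2 * (2 * B₁) ^ d / κ with hM
  have hM0 : 0 < M := by positivity
  set B₂ : ℝ := max 1 M * Real.exp (|D|) with hB₂
  -- The rate 1/4 of the Chernoff exponent is divided by d + 1 when the (d+1)-th root is taken.
  refine ⟨B₁ + B₂, 1 / (4 * ((d : ℝ) + 1)), by positivity, by positivity, ?_⟩
  intro l r hr hsupp hint hA2 hlow
  obtain ⟨S, hSp, hchar, hmgf⟩ := exists_charFun_eq_exp_integral_compensatedExp hint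
  have hdecay : ∀ ξ, ‖charFun S ((2 * Real.pi) • ξ)‖ ≤
      Real.exp c₀ * C * (1 + r * ‖ξ‖) ^ (-((d : ℝ) + 2)) := by
    intro ξ
    rw [hchar, norm_exp_integral_compensatedExp hint]
    have h1 := hlow ((2 * Real.pi) • ξ)
    have h2 : (r * ‖ξ‖) ^ α ≤ (r * ‖(2 * Real.pi) • ξ‖) ^ α := by
      rw [norm_smul, Real.norm_eq_abs, abs_of_pos (by positivity)]
      gcongr
      nlinarith [norm_nonneg ξ, Real.pi_gt_three]
    have h3 := hCb (r * ‖ξ‖) (by positivity)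
    -- The factor e^{c₀} is the price of the -1 in the lower bound on the exponent.
    calc _ ≤ Real.exp (c₀ + -(c₀ * (r * ‖ξ‖) ^ α)) := by
          apply Real.exp_le_exp.2
          nlinarith
      _ ≤ _ := by
          rw [Real.exp_add, mul_assoc]
          gcongr
  obtain ⟨s, hsc, hs0, hsd, hsb, hsl⟩ := hdens S (Real.exp c₀ * C) r (by positivity) hr hdecay
  rw [← hB₁] at hsb hsl
  have hrd : 0 < r ^ d := by positivity
  refine ⟨S, s, hSp, hchar, hsc, hs0, hsd, fun x => (hsb x).trans ?_, fun x => ?_⟩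
  · gcongr
    have : 0 < B₂ := by positivity
    linarith
  have hB12 : B₁ ≤ B₁ + B₂ := by
    have : 0 < B₂ := by positivity
    linarith
  -- The Chernoff direction requires x ≠ 0, and the ball of radius ρ requires s(x) > 0.
  by_cases hx0 : x = 0
  · subst hx0
    simp only [norm_zero, zero_div, mul_zero, zero_mul, Real.exp_zero, mul_one]
    exact (hsb 0).trans (by gcongr)
  rcases (hs0 x).eq_or_lt with hsx | hsx
  · rw [← hsx]; positivity
  set v : ℝ := ‖x‖ / r with hv
  have hv0 : 0 ≤ v := by positivity
  obtain ⟨k, hk0, hk⟩ := hD v hv0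
  set Λ : ℝ := B₁ * (r ^ d)⁻¹ * r⁻¹ with hΛ
  have hΛ0 : 0 < Λ := by positivity
  set ρ : ℝ := s x / (2 * Λ) with hρ
  -- The sup bound on s keeps ρ below r/2; this accounts for the term k/2 in
  -- `exists_chernoff_exponent`.
  have hρr : ρ ≤ r / 2 := by
    rw [hρ, div_le_iff₀ (by positivity)]
    have h1 := hsb x
    have h2 : r / 2 * (2 * Λ) = B₁ * (r ^ d)⁻¹ := by rw [hΛ]; field_simp
    linarith
  have hnx : 0 < ‖x‖ := norm_pos_iff.2 hx0
  have hball : S (Metric.ball x ρ) ≤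
      ENNReal.ofReal (Real.exp (A * (k ^ 2 * Real.exp k) + k / 2 - k * v)) := by
    -- The tilt points towards x and has length k/r, the natural unit for jumps of size at most r.
    set ζ : E := (k / r / ‖x‖) • x with hζ
    have hζn : ‖ζ‖ = k / r := by
      rw [hζ, norm_smul, Real.norm_eq_abs, abs_of_nonneg (by positivity)]
      field_simp
    have hζx : ⟪ζ, x⟫ = k * v := by
      rw [hζ, real_inner_smul_left, real_inner_self_eq_norm_sq, hv]
      field_simp
    have h1 := (exp_mul_measure_ball_le S ζ x ρ).trans (hmgf r hsupp ζ)
    rw [hζx, hζn] at h1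
    have h2 : Real.exp ((k / r) ^ 2 * Real.exp (k / r * r) * ∫ y, ‖y‖ ^ 2 ∂l) ≤
        Real.exp (A * (k ^ 2 * Real.exp k)) := by
      apply Real.exp_le_exp.2
      rw [div_mul_cancel₀ _ hr.ne']
      calc _ ≤ (k / r) ^ 2 * Real.exp k * (A * r ^ 2) := by gcongr
        _ = _ := by field_simp
    have h3 : Real.exp (k * v - k / 2) ≤ Real.exp (k * v - k / r * ρ) := by
      apply Real.exp_le_exp.2
      have : k / r * ρ ≤ k / r * (r / 2) := by gcongr
      have h4 : k / r * (r / 2) = k / 2 := by field_simp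
      linarith
    have h4 : ENNReal.ofReal (Real.exp (k * v - k / 2)) * S (Metric.ball x ρ) ≤
        ENNReal.ofReal (Real.exp (A * (k ^ 2 * Real.exp k))) :=
      le_trans (mul_le_mul_left (ENNReal.ofReal_le_ofReal h3) _)
        (h1.trans (ENNReal.ofReal_le_ofReal h2))
    have h5 : Real.exp (A * (k ^ 2 * Real.exp k) + k / 2 - k * v) =
        Real.exp (A * (k ^ 2 * Real.exp k)) / Real.exp (k * v - k / 2) := by
      rw [← Real.exp_sub]; congr 1; ring
    rw [h5, ENNReal.ofReal_div_of_pos (Real.exp_pos _), ENNReal.le_div_iff_mul_le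
      (Or.inl (by simp [Real.exp_pos])) (Or.inl ENNReal.ofReal_ne_top), mul_comm]
    exact h4
  have hpow := lipschitz_density_pow_le hsd hΛ0 hsl hsx (Real.exp_pos _).le hball
  rw [← hκ, ← hρ, ← hd] at hpow
  have hpow2 : (s x * r ^ d) ^ (d + 1) ≤
      M * Real.exp (A * (k ^ 2 * Real.exp k) + k / 2 - k * v) := by
    have h1 : s x / 2 * (ρ ^ d * κ) = (s x * r ^ d) ^ (d + 1) / M := by
      have h2 : ρ = s x * r ^ d * r / (2 * B₁) := by rw [hρ, hΛ]; field_simp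
      rw [h2, hM, div_pow, mul_pow (s x * r ^ d) r, pow_succ]
      field_simp
    rw [h1, div_le_iff₀ hM0] at hpow
    linarith
  have hpow3 : (s x * r ^ d) ^ (d + 1) ≤
      (B₂ * Real.exp (-(1 / (4 * ((d : ℝ) + 1))) * v * Real.log (1 + v))) ^ (d + 1) := by
    refine hpow2.trans ?_
    rw [hB₂, mul_pow, mul_pow, ← Real.exp_nat_mul, ← Real.exp_nat_mul, mul_assoc, ← Real.exp_add]
    have h1 : M ≤ max 1 M ^ (d + 1) :=
      (le_max_right _ _).trans (le_self_pow₀ (le_max_left _ _) (by omega))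
    gcongr
    push_cast
    have h2 : ((d : ℝ) + 1) * (-(1 / (4 * ((d : ℝ) + 1))) * v * Real.log (1 + v)) =
        -(v * Real.log (1 + v) / 4) := by field_simp
    have h3 : D ≤ ((d : ℝ) + 1) * |D| := by
      nlinarith [le_abs_self D, abs_nonneg D, Nat.cast_nonneg (α := ℝ) d]
    rw [h2]
    linarith
  have hfin := (pow_le_pow_iff_left₀ (by positivity) (by positivity) (by omega)).1 hpow3
  calc s x = s x * r ^ d * (r ^ d)⁻¹ := by field_simp
    _ ≤ B₂ * Real.exp (-(1 / (4 * ((d : ℝ) + 1))) * v * Real.log (1 + v)) * (r ^ d)⁻¹ := by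
        gcongr
    _ = B₂ * (r ^ d)⁻¹ * Real.exp (-(1 / (4 * ((d : ℝ) + 1))) * v * Real.log (1 + v)) := by ring
    _ ≤ _ := by
        gcongr
        linarith

end

/-! ### Masses of balls under convolution and for compound Poisson laws -/

section

variable {E : Type*} [NormedAddCommGroup E] [InnerProductSpace ℝ E] [FiniteDimensional ℝ E]
  [MeasurableSpace E] [BorelSpace E]

theorem measurableSet_ball_inter_le_norm (w : E) (ρ R : ℝ) :
    MeasurableSet (Metric.ball w ρ ∩ {y | R ≤ ‖y‖}) :=
  measurableSet_ball.inter (measurableSet_le measurable_const measurable_norm)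

/-- Bounds on the mass of balls far from the origin are stable under convolution. -/
theorem conv_ball_inter_le {l₁ l₂ : Measure E} [IsFiniteMeasure l₁] [IsFiniteMeasure l₂]
    {ρ C₁ C₂ L₁ L₂ D : ℝ} {h : ℝ → ℝ} (hC₁ : 0 ≤ C₁) (hC₂ : 0 ≤ C₂) (hL₁ : 0 ≤ L₁) (hL₂ : 0 ≤ L₂)
    (hD : ∀ R, 0 ≤ R → 0 ≤ h R ∧ h (R / 2) ≤ D * h R)
    (hu₁ : l₁ Set.univ ≤ ENNReal.ofReal L₁) (hu₂ : l₂ Set.univ ≤ ENNReal.ofReal L₂)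
    (hb₁ : ∀ w R, 0 ≤ R →
      l₁ (Metric.ball w ρ ∩ {y | R ≤ ‖y‖}) ≤ ENNReal.ofReal (C₁ * h R))
    (hb₂ : ∀ w R, 0 ≤ R →
      l₂ (Metric.ball w ρ ∩ {y | R ≤ ‖y‖}) ≤ ENNReal.ofReal (C₂ * h R))
    (w : E) {R : ℝ} (hR : 0 ≤ R) :
    (l₁.conv l₂) (Metric.ball w ρ ∩ {y | R ≤ ‖y‖}) ≤
      ENNReal.ofReal (D * (C₁ * L₂ + C₂ * L₁) * h R) := by
  have hR2 : 0 ≤ R / 2 := by linarith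
  obtain ⟨hh0, hhD⟩ := hD R hR
  have hh2 := (hD (R / 2) hR2).1
  rw [Measure.conv, Measure.map_apply (by fun_prop) (measurableSet_ball_inter_le_norm w ρ R)]
  set S₁ : Set (E × E) := {p | p.1 + p.2 ∈ Metric.ball w ρ ∧ R / 2 ≤ ‖p.1‖} with hS₁
  set S₂ : Set (E × E) := {p | p.1 + p.2 ∈ Metric.ball w ρ ∧ R / 2 ≤ ‖p.2‖} with hS₂
  have hm₁ : MeasurableSet S₁ :=
    (measurableSet_ball.preimage (by fun_prop : Measurable fun p : E × E => p.1 + p.2)).inter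
      (measurableSet_le measurable_const measurable_fst.norm)
  have hm₂ : MeasurableSet S₂ :=
    (measurableSet_ball.preimage (by fun_prop : Measurable fun p : E × E => p.1 + p.2)).inter
      (measurableSet_le measurable_const measurable_snd.norm)
  -- If x + y has norm at least R, one summand has norm at least R/2. With the other summand fixed,
  -- it lies in a translated ball, whence the need for bounds uniform in the centre.
  have hsub : (fun p : E × E => p.1 + p.2) ⁻¹' (Metric.ball w ρ ∩ {y | R ≤ ‖y‖}) ⊆ S₁ ∪ S₂ := by
    rintro ⟨x, y⟩ ⟨hp1, hp2⟩
    have hp2' : R ≤ ‖x + y‖ := hp2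
    have := norm_add_le x y
    rcases le_total (R / 2) ‖x‖ with hx | hx
    · exact Or.inl ⟨hp1, hx⟩
    · exact Or.inr ⟨hp1, show R / 2 ≤ ‖y‖ by linarith⟩
  have h₁ : (l₁.prod l₂) S₁ ≤ ENNReal.ofReal (C₁ * L₂ * h (R / 2)) := by
    rw [Measure.prod_apply_symm hm₁]
    calc ∫⁻ y, l₁ ((fun x => (x, y)) ⁻¹' S₁) ∂l₂
        ≤ ∫⁻ y, ENNReal.ofReal (C₁ * h (R / 2)) ∂l₂ := by
          refine lintegral_mono fun y => le_trans (measure_mono ?_) (hb₁ (w - y) (R / 2) hR2)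
          rintro x ⟨hx1, hx2⟩
          refine ⟨?_, hx2⟩
          rw [mem_ball_iff_norm] at hx1 ⊢
          rwa [show x - (w - y) = x + y - w by abel]
      _ = ENNReal.ofReal (C₁ * h (R / 2)) * l₂ Set.univ := lintegral_const _
      _ ≤ ENNReal.ofReal (C₁ * h (R / 2)) * ENNReal.ofReal L₂ := by gcongr
      _ = _ := by
          rw [← ENNReal.ofReal_mul (by positivity)]
          congr 1
          ring
  have h₂ : (l₁.prod l₂) S₂ ≤ ENNReal.ofReal (C₂ * L₁ * h (R / 2)) := by
    rw [Measure.prod_apply hm₂]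
    calc ∫⁻ x, l₂ (Prod.mk x ⁻¹' S₂) ∂l₁
        ≤ ∫⁻ x, ENNReal.ofReal (C₂ * h (R / 2)) ∂l₁ := by
          refine lintegral_mono fun x => le_trans (measure_mono ?_) (hb₂ (w - x) (R / 2) hR2)
          rintro y ⟨hx1, hx2⟩
          refine ⟨?_, hx2⟩
          rw [mem_ball_iff_norm] at hx1 ⊢
          rwa [show y - (w - x) = x + y - w by abel]
      _ = ENNReal.ofReal (C₂ * h (R / 2)) * l₁ Set.univ := lintegral_const _
      _ ≤ ENNReal.ofReal (C₂ * h (R / 2)) * ENNReal.ofReal L₁ := by gcongr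
      _ = _ := by
          rw [← ENNReal.ofReal_mul (by positivity)]
          congr 1
          ring
  calc _ ≤ (l₁.prod l₂) S₁ + (l₁.prod l₂) S₂ := (measure_mono hsub).trans (measure_union_le _ _)
    _ ≤ ENNReal.ofReal (C₁ * L₂ * h (R / 2)) + ENNReal.ofReal (C₂ * L₁ * h (R / 2)) :=
        add_le_add h₁ h₂
    _ = ENNReal.ofReal ((C₁ * L₂ + C₂ * L₁) * h (R / 2)) := by
        rw [← ENNReal.ofReal_add (by positivity) (by positivity), add_mul]
    _ ≤ _ := by
        refine ENNReal.ofReal_le_ofReal ?_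
        calc (C₁ * L₂ + C₂ * L₁) * h (R / 2) ≤ (C₁ * L₂ + C₂ * L₁) * (D * h R) := by gcongr
          _ = _ := by ring

/-- Any of the n + 1 summands may be the large one, and each successive halving of R costs a factor
D. The resulting n D^n growth is harmless against n!. -/
theorem convPow_succ_ball_inter_le {l : Measure E} [IsFiniteMeasure l]
    {ρ C L D : ℝ} {h : ℝ → ℝ} (hC : 0 ≤ C) (hL : 0 ≤ L) (hD1 : 1 ≤ D)
    (hD : ∀ R, 0 ≤ R → 0 ≤ h R ∧ h (R / 2) ≤ D * h R) (hu : l Set.univ ≤ ENNReal.ofReal L)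
    (hb : ∀ w R, 0 ≤ R → l (Metric.ball w ρ ∩ {y | R ≤ ‖y‖}) ≤ ENNReal.ofReal (C * h R))
    (n : ℕ) (w : E) {R : ℝ} (hR : 0 ≤ R) :
    convPow l (n + 1) (Metric.ball w ρ ∩ {y | R ≤ ‖y‖}) ≤
      ENNReal.ofReal (C * (n + 1) * (D * L) ^ n * h R) := by
  induction n generalizing w R with
  | zero =>
    rw [convPow, convPow, Measure.dirac_zero_conv]
    simpa using hb w R hR
  | succ n ih =>
    rw [convPow]
    have hun : convPow l (n + 1) Set.univ ≤ ENNReal.ofReal (L ^ (n + 1)) := by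
      rw [convPow_univ, ENNReal.ofReal_pow hL]
      gcongr
    refine (conv_ball_inter_le (by positivity) hC (by positivity) hL hD hun hu
      (fun w R hR => ih w hR) hb w hR).trans (ENNReal.ofReal_le_ofReal ?_)
    refine mul_le_mul_of_nonneg_right ?_ (hD R hR).1
    have h1 : D ≤ D ^ (n + 1) := le_self_pow₀ hD1 (by omega)
    have h2 : D * L ^ (n + 1) ≤ (D * L) ^ (n + 1) := by rw [mul_pow]; gcongr
    calc D * (C * (n + 1) * (D * L) ^ n * L + C * L ^ (n + 1))
        = C * ((n + 1) * (D * L) ^ (n + 1) + D * L ^ (n + 1)) := by ring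
      _ ≤ C * ((n + 1) * (D * L) ^ (n + 1) + (D * L) ^ (n + 1)) := by gcongr
      _ = _ := by push_cast; ring

/-- A compound Poisson distribution is the sum of an atom at `0` and a measure satisfying the same
bounds on balls as its Lévy measure. -/
theorem exists_compoundPoisson_le (l : Measure E) [IsFiniteMeasure l]
    {L D : ℝ} {h : ℝ → ℝ} (hL : 0 ≤ L) (hD1 : 1 ≤ D)
    (hD : ∀ R, 0 ≤ R → 0 ≤ h R ∧ h (R / 2) ≤ D * h R) (hu : l Set.univ ≤ ENNReal.ofReal L) :
    ∃ T : Measure E, compoundPoisson l ≤ Measure.dirac 0 + T ∧ T Set.univ ≤ 1 ∧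
      ∀ ρ C : ℝ, 0 ≤ C →
        (∀ w R, 0 ≤ R → l (Metric.ball w ρ ∩ {y | R ≤ ‖y‖}) ≤ ENNReal.ofReal (C * h R)) →
        ∀ w R, 0 ≤ R → T (Metric.ball w ρ ∩ {y | R ≤ ‖y‖}) ≤
          ENNReal.ofReal (C * Real.exp (D * L) * h R) := by
  set a : ℝ≥0∞ := ENNReal.ofReal (Real.exp (-l.real Set.univ)) with ha
  have ha1 : a ≤ 1 := by
    rw [ha, ENNReal.ofReal_le_one, Real.exp_le_one_iff]
    linarith [measureReal_nonneg (μ := l) (s := Set.univ)]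
  -- All terms of the Poisson series except the zeroth, which is the atom at 0.
  set T : Measure E := a •
    Measure.sum (fun n => ENNReal.ofReal (((n + 1).factorial : ℝ)⁻¹) • convPow l (n + 1)) with hT
  have hTapply : ∀ A, MeasurableSet A → T A =
      a * ∑' n : ℕ, ENNReal.ofReal (((n + 1).factorial : ℝ)⁻¹) * convPow l (n + 1) A := by
    intro A hA
    rw [hT, Measure.smul_apply, Measure.sum_apply _ hA]
    simp
  have hsplit : ∀ A, MeasurableSet A →
      compoundPoisson l A = a * Measure.dirac 0 A + T A := by
    intro A hA
    rw [hTapply A hA, compoundPoisson, Measure.smul_apply, Measure.sum_apply _ hA,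
      tsum_eq_zero_add' ENNReal.summable, ← ha, ← mul_add]
    simp [convPow]
  refine ⟨T, ?_, ?_, ?_⟩
  · refine Measure.le_iff.2 fun A hA => ?_
    rw [hsplit A hA, Measure.add_apply]
    gcongr
    exact mul_le_of_le_one_left zero_le ha1
  · rw [← measure_univ (μ := compoundPoisson l), hsplit _ MeasurableSet.univ]
    exact le_add_self
  · intro ρ C hC hb w R hR
    rw [hTapply _ (measurableSet_ball_inter_le_norm w ρ R)]
    calc _ ≤ 1 * ∑' n : ℕ, ENNReal.ofReal (((n + 1).factorial : ℝ)⁻¹) *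
          ENNReal.ofReal (C * (n + 1) * (D * L) ^ n * h R) := by
          gcongr with n
          exact convPow_succ_ball_inter_le hC hL hD1 hD hu hb n w hR
      -- The factor n + 1 cancels against (n+1)!, leaving the exponential series of DL.
      _ = ∑' n : ℕ, ENNReal.ofReal (C * h R) *
          (ENNReal.ofReal ((n.factorial : ℝ)⁻¹) * ENNReal.ofReal (D * L) ^ n) := by
          rw [one_mul]
          have hh := (hD R hR).1
          congr with n
          rw [← ENNReal.ofReal_pow (by positivity), ← ENNReal.ofReal_mul (by positivity),
            ← ENNReal.ofReal_mul (by positivity), ← ENNReal.ofReal_mul (by positivity),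
            Nat.factorial_succ]
          congr 1
          push_cast
          field_simp
      _ = _ := by
          rw [ENNReal.tsum_mul_left, tsum_ofReal_inv_factorial_mul_pow (by positivity),
            ← ENNReal.ofReal_mul (mul_nonneg hC (hD R hR).1)]
          congr 1
          ring

/-- The convolution of a finite measure with an absolutely continuous measure. -/
theorem conv_withDensity_eq (Q : Measure E) [IsFiniteMeasure Q] {s : E → ℝ} (hs : Continuous s)
    (hs0 : ∀ x, 0 ≤ s x) {B : ℝ} (hsB : ∀ x, s x ≤ B) :
    Q.conv (volume.withDensity fun x => ENNReal.ofReal (s x)) =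
      volume.withDensity (fun x => ENNReal.ofReal (∫ y, s (x - y) ∂Q)) := by
  ext A hA
  have hm : Measurable (A.indicator (fun _ => (1 : ℝ≥0∞))) := measurable_const.indicator hA
  have hsm : Measurable s := hs.measurable
  have hint : ∀ x, Integrable (fun y => s (x - y)) Q := fun x =>
    (integrable_const B).mono' (by fun_prop) (ae_of_all _ fun y => by
      rw [Real.norm_eq_abs, abs_of_nonneg (hs0 _)]; exact hsB _)
  have h1 : ∀ x, ENNReal.ofReal (∫ y, s (x - y) ∂Q) = ∫⁻ y, ENNReal.ofReal (s (x - y)) ∂Q :=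
    fun x => ofReal_integral_eq_lintegral_ofReal (hint x) (ae_of_all _ fun y => hs0 _)
  simp_rw [h1]
  rw [← lintegral_indicator_one hA, ← lintegral_indicator_one hA]
  simp only [Pi.one_def]
  rw [Measure.lintegral_conv hm, lintegral_withDensity_eq_lintegral_mul _
    (Measurable.lintegral_prod_right' (f := fun p : E × E => ENNReal.ofReal (s (p.1 - p.2)))
      (by fun_prop)) hm]
  calc ∫⁻ x, ∫⁻ y, A.indicator (fun _ => 1) (x + y)
        ∂(volume.withDensity fun x => ENNReal.ofReal (s x)) ∂Q
      = ∫⁻ x, ∫⁻ y, ENNReal.ofReal (s (y - x)) * A.indicator (fun _ => 1) y ∂volume ∂Q := by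
        congr with x
        rw [lintegral_withDensity_eq_lintegral_mul _ (by fun_prop) (by fun_prop),
          ← lintegral_add_right_eq_self
            (fun y => ENNReal.ofReal (s (y - x)) * A.indicator (fun _ => 1) y) x]
        simp [add_comm]
      _ = ∫⁻ y, ∫⁻ x, ENNReal.ofReal (s (y - x)) * A.indicator (fun _ => 1) y ∂Q ∂volume := by
        rw [lintegral_lintegral_swap]
        fun_prop
      _ = _ := by
        congr with y
        rw [lintegral_mul_const _ (by fun_prop)]
        rfl

theorem continuous_integral_comp_sub (Q : Measure E) [IsFiniteMeasure Q] {s : E → ℝ}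
    (hs : Continuous s) (hs0 : ∀ x, 0 ≤ s x) {B : ℝ} (hsB : ∀ x, s x ≤ B) :
    Continuous (fun x => ∫ y, s (x - y) ∂Q) := by
  refine continuous_of_dominated (bound := fun _ => B) (fun x => ?_) (fun x => ?_)
    (integrable_const B) (ae_of_all _ fun y => by fun_prop)
  · exact Continuous.aestronglyMeasurable (by fun_prop)
  · exact ae_of_all _ fun y => by rw [Real.norm_eq_abs, abs_of_nonneg (hs0 _)]; exact hsB _

end

/-! ### Density estimate for a general Lévy measure cut at radius r -/

section

/-- Sums the contributions of the shells kr ≤ |x - y| < (k+1)r: the exponential bounds the density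
there, the power comes from the mass of the ball. Since log(1+k) ≥ log 2 for k ≥ 1, the decay is at
least geometric. -/
theorem exists_tsum_exp_log_mul_rpow_le {c γ : ℝ} (hc : 0 < c) (hγ : 0 ≤ γ) :
    ∃ K : ℝ, 0 < K ∧
      ∑' k : ℕ, ENNReal.ofReal (Real.exp (-c * k * Real.log (1 + k)) * ((k : ℝ) + 1) ^ γ) ≤
        ENNReal.ofReal K := by
  obtain ⟨C, hC, hCb⟩ := exists_exp_neg_rpow_le (α := 1) (c := c * Real.log 2) (N := γ + 2)
    one_pos (by have := Real.log_pos one_lt_two; positivity) (by linarith)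
  have hsum : Summable fun k : ℕ => C * ((k : ℝ) + 1) ^ (-2 : ℝ) := by
    refine Summable.mul_left C ?_
    have := (summable_nat_add_iff 1).2 (Real.summable_nat_rpow (p := -2).2 (by norm_num))
    simpa using this
  have hle : ∀ k : ℕ, Real.exp (-c * k * Real.log (1 + k)) * ((k : ℝ) + 1) ^ γ ≤
      C * ((k : ℝ) + 1) ^ (-2 : ℝ) := by
    intro k
    have hk : (0 : ℝ) < 1 + k := by positivity
    have h1 : Real.exp (-c * k * Real.log (1 + k)) ≤ Real.exp (-(c * Real.log 2 * (k : ℝ) ^ (1 : ℝ))) := by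
      apply Real.exp_le_exp.2
      rw [Real.rpow_one]
      rcases Nat.eq_zero_or_pos k with h0 | h0
      · simp [h0]
      · have h2 : Real.log 2 ≤ Real.log (1 + k) := by
          apply Real.log_le_log two_pos
          have : (1 : ℝ) ≤ k := by exact_mod_cast h0
          linarith
        have h3 : c * k * Real.log 2 ≤ c * k * Real.log (1 + k) := by gcongr
        linarith
    calc _ ≤ C * (1 + (k : ℝ)) ^ (-(γ + 2)) * (1 + (k : ℝ)) ^ γ := by
          rw [add_comm (k : ℝ) 1]
          gcongr
          exact h1.trans (hCb k (by positivity))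
      _ = _ := by
          rw [mul_assoc, ← Real.rpow_add hk, add_comm (1 : ℝ)]
          congr 2
          ring
  refine ⟨(∑' k : ℕ, C * ((k : ℝ) + 1) ^ (-2 : ℝ)) + 1, by positivity, ?_⟩
  calc _ ≤ ∑' k : ℕ, ENNReal.ofReal (C * ((k : ℝ) + 1) ^ (-2 : ℝ)) := by
        exact ENNReal.tsum_le_tsum fun k => ENNReal.ofReal_le_ofReal (hle k)
    _ = ENNReal.ofReal (∑' k : ℕ, C * ((k : ℝ) + 1) ^ (-2 : ℝ)) :=
        (ENNReal.ofReal_tsum_of_nonneg (fun k => by positivity) hsum).symm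
    _ ≤ _ := ENNReal.ofReal_le_ofReal (by linarith)

theorem exp_neg_mul_log_antitone {c u v : ℝ} (hc : 0 ≤ c) (hu : 0 ≤ u) (huv : u ≤ v) :
    Real.exp (-c * v * Real.log (1 + v)) ≤ Real.exp (-c * u * Real.log (1 + u)) := by
  apply Real.exp_le_exp.2
  have h1 : Real.log (1 + u) ≤ Real.log (1 + v) := Real.log_le_log (by linarith) (by linarith)
  have h2 : 0 ≤ Real.log (1 + u) := Real.log_nonneg (by linarith)
  have : c * u * Real.log (1 + u) ≤ c * v * Real.log (1 + v) :=
    mul_le_mul (by gcongr) h1 h2 (by nlinarith)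
  linarith

variable {E : Type*} [NormedAddCommGroup E] [InnerProductSpace ℝ E] [FiniteDimensional ℝ E]
  [MeasurableSpace E] [BorelSpace E]

/-- Averaging a rapidly decreasing function against a measure with bounds on balls. -/
theorem lintegral_comp_sub_le {T : Measure E} (hT1 : T Set.univ ≤ 1) {s : E → ℝ} {b c r γ K H : ℝ}
    (hb : 0 ≤ b) (hc : 0 < c) (hr : 0 < r) (hH : 0 ≤ H) (hK : 0 < K)
    (hKs : ∑' k : ℕ, ENNReal.ofReal (Real.exp (-c * k * Real.log (1 + k)) * ((k : ℝ) + 1) ^ γ) ≤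
      ENNReal.ofReal K)
    (hs : ∀ x, s x ≤ b * Real.exp (-c * (‖x‖ / r) * Real.log (1 + ‖x‖ / r))) (x : E)
    (hT : ∀ ρ, 0 < ρ → T (Metric.ball x ρ ∩ {y | ‖x‖ / 2 ≤ ‖y‖}) ≤
      ENNReal.ofReal (ρ ^ γ * H)) :
    ∫⁻ y, ENNReal.ofReal (s (x - y)) ∂T ≤
      ENNReal.ofReal (b * (Real.exp (-c * (‖x‖ / 2 / r) * Real.log (1 + ‖x‖ / 2 / r)) +
        K * r ^ γ * H)) := by
  set e : ℝ → ℝ := fun v => Real.exp (-c * v * Real.log (1 + v)) with he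
  have he0 : ∀ v, 0 < e v := fun v => Real.exp_pos _
  set U : Set E := {y | ‖x‖ / 2 ≤ ‖y‖} with hU
  have hUm : MeasurableSet U := measurableSet_le measurable_const measurable_norm
  -- If |y| < |x|/2 then |x - y| ≥ |x|/2 and s is small. Otherwise y lies in some shell around x and
  -- at distance at least |x|/2 from 0, where T has small mass.
  have hpt : ∀ y, ENNReal.ofReal (s (x - y)) ≤ ENNReal.ofReal (b * e (‖x‖ / 2 / r)) +
      ∑' k : ℕ, (Metric.ball x (((k : ℝ) + 1) * r) ∩ U).indicator
        (fun _ => ENNReal.ofReal (b * e k)) y := by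
    intro y
    by_cases hy : y ∈ U
    · refine le_add_left ?_
      have hq : 0 ≤ ‖x - y‖ / r := by positivity
      set k := ⌊‖x - y‖ / r⌋₊ with hk
      refine le_trans ?_ (ENNReal.le_tsum k)
      have hmem : y ∈ Metric.ball x (((k : ℝ) + 1) * r) ∩ U := by
        refine ⟨?_, hy⟩
        rw [Metric.mem_ball, dist_comm, dist_eq_norm, ← div_lt_iff₀ hr]
        exact Nat.lt_floor_add_one _
      rw [Set.indicator_of_mem hmem]
      refine ENNReal.ofReal_le_ofReal ((hs _).trans ?_)
      gcongr
      exact exp_neg_mul_log_antitone hc.le (by positivity) (Nat.floor_le hq)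
    · refine le_add_right (ENNReal.ofReal_le_ofReal ((hs _).trans ?_))
      gcongr
      refine exp_neg_mul_log_antitone hc.le (by positivity) ?_
      have h1 : ‖y‖ < ‖x‖ / 2 := not_le.1 hy
      have h2 := norm_sub_norm_le x y
      gcongr
      linarith
  calc _ ≤ ∫⁻ y, (ENNReal.ofReal (b * e (‖x‖ / 2 / r)) +
      ∑' k : ℕ, (Metric.ball x (((k : ℝ) + 1) * r) ∩ U).indicator
        (fun _ => ENNReal.ofReal (b * e k)) y) ∂T := lintegral_mono hpt
    _ = ENNReal.ofReal (b * e (‖x‖ / 2 / r)) * T Set.univ +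
        ∑' k : ℕ, ENNReal.ofReal (b * e k) * T (Metric.ball x (((k : ℝ) + 1) * r) ∩ U) := by
        rw [lintegral_add_left measurable_const, lintegral_const, lintegral_tsum fun k =>
          (measurable_const.indicator (measurableSet_ball.inter hUm)).aemeasurable]
        congr 2 with k
        rw [lintegral_indicator_const (measurableSet_ball.inter hUm)]
    _ ≤ ENNReal.ofReal (b * e (‖x‖ / 2 / r)) * 1 +
        ∑' k : ℕ, ENNReal.ofReal (b * r ^ γ * H) *
          ENNReal.ofReal (e k * ((k : ℝ) + 1) ^ γ) := by
        refine add_le_add (by gcongr) (ENNReal.tsum_le_tsum fun k => ?_)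
        refine (mul_le_mul_right (hT (((k : ℝ) + 1) * r) (by positivity)) _).trans (le_of_eq ?_)
        rw [← ENNReal.ofReal_mul (mul_nonneg hb (he0 _).le), ← ENNReal.ofReal_mul (by positivity),
          Real.mul_rpow (by positivity) hr.le]
        congr 1
        ring
    _ ≤ ENNReal.ofReal (b * e (‖x‖ / 2 / r)) + ENNReal.ofReal (b * r ^ γ * H) *
          ENNReal.ofReal K := by
        rw [mul_one, ENNReal.tsum_mul_left]
        gcongr
    _ = _ := by
        have := he0 (‖x‖ / 2 / r)
        rw [← ENNReal.ofReal_mul (by positivity), ← ENNReal.ofReal_add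
          (mul_nonneg hb this.le) (by positivity)]
        congr 1
        ring

/-- Transition density estimate for an infinitely divisible distribution, in terms of the small
jumps (of size less than `r`) and of the large jumps of its Lévy measure. -/
theorem exists_density_estimate (E : Type*) [NormedAddCommGroup E] [InnerProductSpace ℝ E]
    [FiniteDimensional ℝ E] [MeasurableSpace E] [BorelSpace E] {α c₀ A L D γ : ℝ} (hα : 0 < α)
    (hc₀ : 0 < c₀) (hA : 0 ≤ A) (hL : 0 ≤ L) (hD1 : 1 ≤ D) (hγ : 0 ≤ γ) :
    ∃ B c : ℝ, 0 < B ∧ 0 < c ∧ ∀ (l : Measure E) (r : ℝ) (h : ℝ → ℝ), 0 < r →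
      IntegrableOn (fun y => ‖y‖ ^ 2) (Metric.ball 0 r) l →
      ∫ y in Metric.ball 0 r, ‖y‖ ^ 2 ∂l ≤ A * r ^ 2 →
      (∀ ξ, c₀ * ((r * ‖ξ‖) ^ α - 1) ≤ ∫ y in Metric.ball 0 r, (1 - Real.cos ⟪y, ξ⟫) ∂l) →
      l (Metric.ball 0 r)ᶜ ≤ ENNReal.ofReal L →
      (∀ R, 0 ≤ R → 0 ≤ h R ∧ h (R / 2) ≤ D * h R) →
      (∀ w ρ R, 0 < ρ → 0 ≤ R →
        l ((Metric.ball 0 r)ᶜ ∩ (Metric.ball w ρ ∩ {y | R ≤ ‖y‖})) ≤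
          ENNReal.ofReal (ρ ^ γ * h R)) →
      ∀ a : E, ∃ (P : Measure E) (p : E → ℝ), IsProbabilityMeasure P ∧
        (∀ ξ, charFun P ξ = Complex.exp ((∫ y in Metric.ball 0 r, compensatedExp ξ y ∂l) +
          (∫ y in (Metric.ball 0 r)ᶜ, (Complex.exp (⟪y, ξ⟫ * Complex.I) - 1) ∂l) +
          ⟪a, ξ⟫ * Complex.I)) ∧
        Continuous p ∧ (∀ x, 0 ≤ p x) ∧
        P = volume.withDensity (fun x => ENNReal.ofReal (p x)) ∧
        (∀ x, p x ≤ B * (r ^ Module.finrank ℝ E)⁻¹) ∧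
        ∀ x, p (x + a) ≤ B * (r ^ Module.finrank ℝ E)⁻¹ *
          (Real.exp (-c * (‖x‖ / r) * Real.log (1 + ‖x‖ / 2 / r)) + r ^ γ * h ‖x‖) := by
  obtain ⟨B, c, hB, hc, hsmall⟩ := exists_small_jump_density E hα hc₀ hA
  obtain ⟨K, hK, hKs⟩ := exists_tsum_exp_log_mul_rpow_le hc hγ
  -- The 2 counts the atom at 0 and the points with |y| < |x|/2; the last D is from h(|x|/2) ≤ D
  -- h(|x|); c is halved because the decay is evaluated at |x|/2.
  refine ⟨B * (2 + K * Real.exp (D * L) * D), c / 2, by positivity, by positivity, ?_⟩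
  intro l r h hr hint hA2 hlow hu hh hball a
  set l₂ := l.restrict (Metric.ball 0 r)ᶜ with hl₂
  have hfin : IsFiniteMeasure l₂ := ⟨by
    rw [hl₂, Measure.restrict_apply_univ]; exact hu.trans_lt ENNReal.ofReal_lt_top⟩
  have hsupp : ∀ᵐ y ∂l.restrict (Metric.ball 0 r), ‖y‖ ≤ r :=
    ae_restrict_of_forall_mem measurableSet_ball fun y hy => (mem_ball_zero_iff.1 hy).le
  obtain ⟨S, s, hS, hchar, hsc, hs0, hsd, hsb, hse⟩ :=
    hsmall (l.restrict (Metric.ball 0 r)) r hr hsupp hint hA2 hlow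
  obtain ⟨T, hTle, hT1, hTb⟩ := exists_compoundPoisson_le l₂ hL hD1 hh
    (by rwa [hl₂, Measure.restrict_apply_univ])
  set d := Module.finrank ℝ E with hd
  set b : ℝ := B * (r ^ d)⁻¹ with hb
  have hb0 : 0 < b := by positivity
  set Q : Measure E := (compoundPoisson l₂).map (· + a) with hQ
  have hQp : IsProbabilityMeasure Q := Measure.isProbabilityMeasure_map (by fun_prop)
  have hpb : ∀ x, ∫ y, s (x - y) ∂Q ≤ b := fun x => by
    calc ∫ y, s (x - y) ∂Q ≤ ∫ y, b ∂Q := by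
          refine integral_mono_of_nonneg (ae_of_all _ fun y => hs0 _) (integrable_const b)
            (ae_of_all _ fun y => hsb _)
      _ = b := by simp
  refine ⟨Q.conv S, fun x => ∫ y, s (x - y) ∂Q, inferInstance, fun ξ => ?_,
    continuous_integral_comp_sub Q hsc hs0 hsb, fun x => integral_nonneg fun y => hs0 _, ?_,
    fun x => (hpb x).trans ?_, fun x => ?_⟩
  · have h1 : Integrable (fun x => Complex.exp (⟪x, ξ⟫ * Complex.I)) l₂ :=
      (integrable_const (1 : ℝ)).mono (by fun_prop) (by simp)
    rw [charFun_conv, hQ, charFun_map_add_const, charFun_compoundPoisson, hchar,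
      ← Complex.exp_add, ← Complex.exp_add, integral_sub h1 (integrable_const _), charFun_apply]
    congr 1
    simp
    ring
  · conv_lhs => rw [hsd]
    exact conv_withDensity_eq Q hsc hs0 hsb
  · rw [hb, mul_right_comm]
    have : 0 ≤ K * Real.exp (D * L) * D := by positivity
    nlinarith
  · have hhx := hh ‖x‖ (norm_nonneg x)
    have hhx2 := hh (‖x‖ / 2) (by positivity)
    have hmain := lintegral_comp_sub_le hT1 hb0.le hc hr
      (mul_nonneg (Real.exp_pos (D * L)).le hhx2.1) hK hKs hse x (fun ρ hρ => by
        refine (hTb ρ (ρ ^ γ) (by positivity) (fun w R hR => ?_) x (‖x‖ / 2)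
          (by positivity)).trans (le_of_eq ?_)
        · rw [hl₂, Measure.restrict_apply (measurableSet_ball_inter_le_norm w ρ R), Set.inter_comm]
          exact hball w ρ R hρ hR
        · congr 1; ring)
    have hsm : Measurable s := hsc.measurable
    have hpx : ∫ y, s (x + a - y) ∂Q = ∫ y, s (x - y) ∂compoundPoisson l₂ := by
      rw [hQ, integral_map (by fun_prop) (by fun_prop)]
      simp
    set e₂ := Real.exp (-c * (‖x‖ / 2 / r) * Real.log (1 + ‖x‖ / 2 / r)) with he₂
    have he₂0 : 0 < e₂ := Real.exp_pos _
    -- The first term is the contribution s(x) of the atom, weakened to the decay at |x|/2; the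
    -- second is that of T.
    have hle : ENNReal.ofReal (∫ y, s (x + a - y) ∂Q) ≤
        ENNReal.ofReal (b * e₂ + b * (e₂ + K * r ^ γ * (Real.exp (D * L) * h (‖x‖ / 2)))) := by
      have hint2 : Integrable (fun y => s (x - y)) (compoundPoisson l₂) :=
        (integrable_const b).mono' (by fun_prop) (ae_of_all _ fun y => by
          rw [Real.norm_eq_abs, abs_of_nonneg (hs0 _)]; exact hsb _)
      rw [hpx, ofReal_integral_eq_lintegral_ofReal hint2 (ae_of_all _ fun y => hs0 _)]
      refine (lintegral_mono' hTle le_rfl).trans ?_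
      have hn : 0 ≤ K * r ^ γ * (Real.exp (D * L) * h (‖x‖ / 2)) :=
        mul_nonneg (by positivity) (mul_nonneg (Real.exp_pos _).le hhx2.1)
      rw [lintegral_add_measure, lintegral_dirac' _ (by fun_prop),
        ENNReal.ofReal_add (by positivity) (by positivity)]
      refine add_le_add (ENNReal.ofReal_le_ofReal ?_) hmain
      rw [sub_zero]
      refine (hse x).trans ?_
      gcongr
      refine exp_neg_mul_log_antitone hc.le (by positivity) ?_
      have := norm_nonneg x
      gcongr
      linarith
    have hn : 0 ≤ K * r ^ γ * (Real.exp (D * L) * h (‖x‖ / 2)) :=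
      mul_nonneg (by positivity) (mul_nonneg (Real.exp_pos _).le hhx2.1)
    rw [ENNReal.ofReal_le_ofReal_iff (by positivity)] at hle
    have he : Real.exp (-(c / 2) * (‖x‖ / r) * Real.log (1 + ‖x‖ / 2 / r)) = e₂ := by
      rw [he₂]; congr 1; ring
    show ∫ y, s (x + a - y) ∂Q ≤ _
    rw [he]
    refine hle.trans ?_
    have hrg : 0 < r ^ γ := Real.rpow_pos_of_pos hr γ
    have hg : r ^ γ * h (‖x‖ / 2) ≤ r ^ γ * (D * h ‖x‖) := by gcongr; exact hhx.2
    have hKe : 0 < K * Real.exp (D * L) := by positivity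
    calc b * e₂ + b * (e₂ + K * r ^ γ * (Real.exp (D * L) * h (‖x‖ / 2)))
        = b * (2 * e₂ + K * Real.exp (D * L) * (r ^ γ * h (‖x‖ / 2))) := by ring
      _ ≤ b * (2 * e₂ + K * Real.exp (D * L) * (r ^ γ * (D * h ‖x‖))) := by gcongr
      _ ≤ b * ((2 + K * Real.exp (D * L) * D) * (e₂ + r ^ γ * h ‖x‖)) := by
          have h1 : 0 ≤ K * Real.exp (D * L) * D * e₂ := by positivity
          have h2 : 0 ≤ r ^ γ * h ‖x‖ := mul_nonneg hrg.le hhx.1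
          gcongr
          nlinarith
      _ = _ := by rw [hb]; ring

end

/-! ### The polar Lévy measure: tails and truncated second moments -/

section

theorem lintegral_Ioc_zero_rpow {a r : ℝ} (ha : -1 < a) (hr : 0 ≤ r) :
    ∫⁻ s in Set.Ioc 0 r, ENNReal.ofReal (s ^ a) = ENNReal.ofReal (r ^ (a + 1) / (a + 1)) := by
  have hint := (intervalIntegrable_iff_integrableOn_Ioc_of_le hr).1
    (intervalIntegral.intervalIntegrable_rpow' (a := 0) (b := r) ha)
  rw [← ofReal_integral_eq_lintegral_ofReal hint
    (ae_restrict_of_forall_mem measurableSet_Ioc fun s hs => Real.rpow_nonneg hs.1.le _),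
    ← intervalIntegral.integral_of_le hr, integral_rpow (Or.inl ha),
    Real.zero_rpow (by linarith), sub_zero]

theorem lintegral_Ioi_rpow {a c : ℝ} (ha : a < -1) (hc : 0 < c) :
    ∫⁻ s in Set.Ioi c, ENNReal.ofReal (s ^ a) = ENNReal.ofReal (-c ^ (a + 1) / (a + 1)) := by
  rw [← integral_Ioi_rpow_of_lt ha hc, ofReal_integral_eq_lintegral_ofReal
    (integrableOn_Ioi_rpow_of_lt ha hc)
    (ae_restrict_of_forall_mem measurableSet_Ioi fun s hs =>
      Real.rpow_nonneg (hc.trans hs).le _)]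

variable {d : ℕ} {α m γ K : ℝ}

/-- As α ≤ m, the profile is the smaller of the two powers for every s. The power with α serves
scales r ≤ 1, the one with m scales r > 1. -/
theorem layeredProfile_le_left (hαm : α ≤ m) (s : ℝ) :
    layeredProfile α m s ≤ s ^ (-α - 1) := by
  unfold layeredProfile
  split_ifs with h
  · exact le_rfl
  · exact Real.rpow_le_rpow_of_exponent_le (not_le.1 h).le (by linarith)

theorem layeredProfile_le_right (hαm : α ≤ m) {s : ℝ} (hs : 0 < s) :
    layeredProfile α m s ≤ s ^ (-m - 1) := by
  unfold layeredProfile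
  split_ifs with h
  · exact Real.rpow_le_rpow_of_exponent_ge hs h (by linarith)
  · exact le_rfl

/-- The two regimes merge into one formula because 1 + s is at most 2 for s ≤ 1 and at most 2s for s
> 1. -/
theorem layeredProfile_le (hαm : α ≤ m) {s : ℝ} (hs : 0 < s) :
    layeredProfile α m s ≤ 2 ^ (m - α) * (s ^ (-α - 1) * (1 + s) ^ (α - m)) := by
  have h2 : (2 : ℝ) ^ (m - α) * 2 ^ (α - m) = 1 := by
    rw [← Real.rpow_add two_pos, sub_add_sub_cancel, sub_self, Real.rpow_zero]
  unfold layeredProfile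
  split_ifs with h
  · have h1 : (2 : ℝ) ^ (α - m) ≤ (1 + s) ^ (α - m) :=
      Real.rpow_le_rpow_of_nonpos (by linarith) (by linarith) (by linarith)
    calc s ^ (-α - 1) = s ^ (-α - 1) * (2 ^ (m - α) * 2 ^ (α - m)) := by rw [h2, mul_one]
      _ ≤ s ^ (-α - 1) * (2 ^ (m - α) * (1 + s) ^ (α - m)) := by gcongr
      _ = _ := by ring
  · have h1 : (2 * s) ^ (α - m) ≤ (1 + s) ^ (α - m) :=
      Real.rpow_le_rpow_of_nonpos (by linarith) (by linarith) (by linarith)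
    rw [Real.mul_rpow two_pos.le hs.le] at h1
    calc s ^ (-m - 1) = s ^ (-α - 1) * s ^ (α - m) * (2 ^ (m - α) * 2 ^ (α - m)) := by
          rw [h2, mul_one, ← Real.rpow_add hs]; congr 1; ring
      _ = 2 ^ (m - α) * (s ^ (-α - 1) * (2 ^ (α - m) * s ^ (α - m))) := by ring
      _ ≤ _ := by gcongr

variable {μ : Measure (Metric.sphere (0 : EuclideanSpace ℝ (Fin d)) 1)} [IsFiniteMeasure μ]
  {Q : Metric.sphere (0 : EuclideanSpace ℝ (Fin d)) 1 → ℝ → ℝ}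

theorem lintegral_polarMeasure (hQ : Measurable (Function.uncurry Q))
    {g : EuclideanSpace ℝ (Fin d) → ℝ≥0∞} (hg : Measurable g) :
    ∫⁻ y, g y ∂polarMeasure μ Q = ∫⁻ θ, ∫⁻ s in Set.Ioi (0 : ℝ),
      g (s • (θ : EuclideanSpace ℝ (Fin d))) * ENNReal.ofReal (Q θ s) ∂volume ∂μ := by
  have hm : Measurable (fun p : Metric.sphere (0 : EuclideanSpace ℝ (Fin d)) 1 × ℝ =>
      p.2 • (p.1 : EuclideanSpace ℝ (Fin d))) := by fun_prop
  have hQ' : Measurable (fun p : Metric.sphere (0 : EuclideanSpace ℝ (Fin d)) 1 × ℝ =>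
      ENNReal.ofReal (Q p.1 p.2)) := hQ.ennreal_ofReal
  have hgm : Measurable (fun p : Metric.sphere (0 : EuclideanSpace ℝ (Fin d)) 1 × ℝ =>
      g (p.2 • (p.1 : EuclideanSpace ℝ (Fin d)))) := hg.comp hm
  rw [polarMeasure, lintegral_map hg hm, lintegral_withDensity_eq_lintegral_mul _ hQ' hgm,
    lintegral_prod _ (hQ'.mul hgm).aemeasurable]
  simp only [Pi.mul_apply, mul_comm]

theorem norm_smul_sphere (θ : Metric.sphere (0 : EuclideanSpace ℝ (Fin d)) 1) {s : ℝ}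
    (hs : 0 < s) : ‖s • (θ : EuclideanSpace ℝ (Fin d))‖ = s := by
  rw [norm_smul, norm_eq_of_mem_sphere θ, mul_one, Real.norm_eq_abs, abs_of_pos hs]

theorem lintegral_norm_polarMeasure_le (hQ : Measurable (Function.uncurry Q))
    (hL : IsLayered α m K Q) {g : ℝ → ℝ≥0∞} (hg : Measurable g) :
    ∫⁻ y, g ‖y‖ ∂polarMeasure μ Q ≤
      μ Set.univ * ∫⁻ s in Set.Ioi (0 : ℝ), g s * ENNReal.ofReal (K * layeredProfile α m s) := by
  rw [lintegral_polarMeasure hQ (by fun_prop), mul_comm, ← lintegral_const]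
  refine lintegral_mono fun θ => setLIntegral_mono' measurableSet_Ioi fun s hs => ?_
  rw [norm_smul_sphere θ hs]
  gcongr
  exact (hL θ s hs).2

/-- A sphere meets each ray in one point, and the radial part has a density. Hence strict and weak
inequalities in annuli may be exchanged. -/
theorem polarMeasure_norm_eq (hQ : Measurable (Function.uncurry Q)) (c : ℝ) :
    polarMeasure μ Q {y | ‖y‖ = c} = 0 := by
  have hm : MeasurableSet {y : EuclideanSpace ℝ (Fin d) | ‖y‖ = c} :=
    measurableSet_eq_fun measurable_norm measurable_const
  rw [polarMeasure_apply μ Q hQ _ hm, lintegral_eq_zero_iff' (by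
    refine (Measurable.lintegral_prod_right' (f := fun p :
      Metric.sphere (0 : EuclideanSpace ℝ (Fin d)) 1 × ℝ => Set.indicator {y | ‖y‖ = c}
      (fun _ => ENNReal.ofReal (Q p.1 p.2)) (p.2 • (p.1 : EuclideanSpace ℝ (Fin d)))) ?_).aemeasurable
    exact (hQ.ennreal_ofReal).indicator (hm.preimage (by fun_prop : Measurable (fun p :
      Metric.sphere (0 : EuclideanSpace ℝ (Fin d)) 1 × ℝ =>
        p.2 • (p.1 : EuclideanSpace ℝ (Fin d))))))]
  refine ae_of_all _ fun θ => ?_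
  refine le_antisymm ?_ zero_le
  calc _ ≤ ∫⁻ s in Set.Ioi (0 : ℝ), ({c} : Set ℝ).indicator
          (fun s => ENNReal.ofReal (Q θ s)) s := by
        refine setLIntegral_mono' measurableSet_Ioi fun s hs => ?_
        by_cases h : s = c
        · simp only [h, Set.mem_singleton_iff, Set.indicator_of_mem]
          exact Set.indicator_le_self _ _ _
        · rw [Set.indicator_of_notMem]
          · exact zero_le
          · rw [Set.mem_ofPred_eq, norm_smul_sphere θ hs]
            exact h
    _ = 0 := by
        rw [lintegral_indicator (measurableSet_singleton c)]
        simp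

/-- The exponent a is left free so that a = α can be used for r ≤ 1 and a = m for r > 1. -/
theorem polarMeasure_compl_ball_le (hK : 0 < K)
    (hQ : Measurable (Function.uncurry Q)) (hL : IsLayered α m K Q) {r : ℝ} (hr : 0 < r) {a : ℝ}
    (ha : 0 < a) (hf : ∀ s, 0 < s → layeredProfile α m s ≤ s ^ (-a - 1)) :
    polarMeasure μ Q (Metric.ball 0 r)ᶜ ≤
      ENNReal.ofReal (μ.real Set.univ * K * (r ^ (-a) / a)) := by
  have hpre : (Metric.ball (0 : EuclideanSpace ℝ (Fin d)) r)ᶜ = {y | r ≤ ‖y‖} := by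
    ext y; simp
  have h1 : polarMeasure μ Q (Metric.ball 0 r)ᶜ =
      ∫⁻ y, (Set.Ici r).indicator (fun _ => (1 : ℝ≥0∞)) ‖y‖ ∂polarMeasure μ Q := by
    rw [← lintegral_indicator_one measurableSet_ball.compl, hpre]
    rfl
  rw [h1]
  refine (lintegral_norm_polarMeasure_le hQ hL
    (measurable_const.indicator measurableSet_Ici)).trans ?_
  have h2 : ∫⁻ s in Set.Ioi (0 : ℝ), (Set.Ici r).indicator (fun _ => (1 : ℝ≥0∞)) s *
      ENNReal.ofReal (K * layeredProfile α m s) ≤ ENNReal.ofReal (K * (r ^ (-a) / a)) := by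
    calc _ ≤ ∫⁻ s in Set.Ioi (0 : ℝ), (Set.Ici r).indicator
          (fun s => ENNReal.ofReal K * ENNReal.ofReal (s ^ (-a - 1))) s := by
          refine setLIntegral_mono' measurableSet_Ioi fun s hs => ?_
          by_cases h : s ∈ Set.Ici r
          · rw [Set.indicator_of_mem h, Set.indicator_of_mem h, one_mul,
              ← ENNReal.ofReal_mul hK.le]
            gcongr
            exact hf s hs
          · simp [Set.indicator_of_notMem h]
      _ ≤ ∫⁻ s, (Set.Ici r).indicator
          (fun s => ENNReal.ofReal K * ENNReal.ofReal (s ^ (-a - 1))) s :=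
          setLIntegral_le_lintegral _ _
      _ = ENNReal.ofReal K * ∫⁻ s in Set.Ioi r, ENNReal.ofReal (s ^ (-a - 1)) := by
          rw [lintegral_indicator measurableSet_Ici, lintegral_const_mul _ (by fun_prop),
            setLIntegral_congr Ioi_ae_eq_Ici.symm]
      _ = _ := by
          rw [lintegral_Ioi_rpow (by linarith) hr, ← ENNReal.ofReal_mul hK.le, sub_add_cancel,
            neg_div_neg_eq]
  rw [← ofReal_measureReal (μ := μ) (s := Set.univ), mul_assoc,
    ENNReal.ofReal_mul measureReal_nonneg]
  gcongr

/-- The radial integrand s²·s^{-a-1} = s^{1-a} is integrable at 0 for a = α < 2 and at infinity for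
a = m > 2. The second contribution is absent for r ≤ 1, which leaves the exact order r^{2-α}. -/
theorem setLIntegral_ball_sq_polarMeasure_le (hα : α ∈ Set.Ioo (0 : ℝ) 2) (hm : 2 < m)
    (hK : 0 < K) (hQ : Measurable (Function.uncurry Q)) (hL : IsLayered α m K Q) {r : ℝ}
    (hr : 0 < r) :
    ∫⁻ y in Metric.ball 0 r, ENNReal.ofReal (‖y‖ ^ 2) ∂polarMeasure μ Q ≤
      ENNReal.ofReal (μ.real Set.univ * K *
        (min 1 r ^ (2 - α) / (2 - α) + (if r ≤ 1 then 0 else 1 / (m - 2)))) := by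
  obtain ⟨hα0, hα2⟩ := hα
  have h1 : ∫⁻ y in Metric.ball 0 r, ENNReal.ofReal (‖y‖ ^ 2) ∂polarMeasure μ Q =
      ∫⁻ y, (Set.Iio r).indicator (fun s => ENNReal.ofReal (s ^ 2)) ‖y‖ ∂polarMeasure μ Q := by
    rw [← lintegral_indicator measurableSet_ball]
    congr with y
    by_cases h : ‖y‖ < r
    · rw [Set.indicator_of_mem (mem_ball_zero_iff.2 h), Set.indicator_of_mem (Set.mem_Iio.2 h)]
    · rw [Set.indicator_of_notMem (by simpa using h), Set.indicator_of_notMem (by simpa using h)]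
  rw [h1]
  refine (lintegral_norm_polarMeasure_le hQ hL
    ((by fun_prop : Measurable fun s : ℝ => ENNReal.ofReal (s ^ 2)).indicator
      measurableSet_Iio)).trans ?_
  set p : ℝ := min 1 r with hp
  have hp0 : 0 < p := lt_min one_pos hr
  have hsplit : ∀ s, 0 < s → (Set.Iio r).indicator (fun s => ENNReal.ofReal (s ^ 2)) s *
      ENNReal.ofReal (K * layeredProfile α m s) ≤
      ENNReal.ofReal K * ((Set.Ioc 0 p).indicator (fun s => ENNReal.ofReal (s ^ (1 - α))) s +
        (if r ≤ 1 then 0 else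
          (Set.Ioi 1).indicator (fun s => ENNReal.ofReal (s ^ (1 - m))) s)) := by
    intro s hs
    by_cases h : s < r
    swap
    · rw [Set.indicator_of_notMem (by simpa using h), zero_mul]
      exact zero_le
    rw [Set.indicator_of_mem (Set.mem_Iio.2 h), ← ENNReal.ofReal_mul (by positivity),
      mul_left_comm, ENNReal.ofReal_mul hK.le]
    gcongr
    have hs2 : ∀ a : ℝ, s ^ 2 * s ^ (-a - 1) = s ^ (1 - a) := fun a => by
      rw [← Real.rpow_natCast, ← Real.rpow_add hs]; congr 1; push_cast; ring
    rcases le_or_gt s 1 with h' | h'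
    · rw [Set.indicator_of_mem (Set.mem_Ioc.2 ⟨hs, le_min h' h.le⟩), ← hs2]
      refine le_add_right ?_
      gcongr
      exact layeredProfile_le_left (by linarith) s
    · rw [if_neg (by linarith), Set.indicator_of_mem (a := s) (s := Set.Ioi 1) h', ← hs2]
      refine le_add_left ?_
      gcongr
      exact layeredProfile_le_right (by linarith) hs
  have h2 : ∫⁻ s in Set.Ioi (0 : ℝ), (Set.Iio r).indicator (fun s => ENNReal.ofReal (s ^ 2)) s *
      ENNReal.ofReal (K * layeredProfile α m s) ≤
      ENNReal.ofReal (K * (p ^ (2 - α) / (2 - α) + (if r ≤ 1 then 0 else 1 / (m - 2)))) := by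
    have hmi : Measurable
        ((Set.Ioc 0 p).indicator (fun s : ℝ => ENNReal.ofReal (s ^ (1 - α)))) :=
      Measurable.indicator (by fun_prop) measurableSet_Ioc
    have hmj : Measurable
        ((Set.Ioi 1).indicator (fun s : ℝ => ENNReal.ofReal (s ^ (1 - m)))) :=
      Measurable.indicator (by fun_prop) measurableSet_Ioi
    refine (setLIntegral_mono' measurableSet_Ioi fun s hs => hsplit s hs).trans ?_
    refine (setLIntegral_le_lintegral _ _).trans ?_
    have hi : ∫⁻ s, (Set.Ioc 0 p).indicator (fun s : ℝ => ENNReal.ofReal (s ^ (1 - α))) s =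
        ENNReal.ofReal (p ^ (2 - α) / (2 - α)) := by
      rw [lintegral_indicator measurableSet_Ioc, lintegral_Ioc_zero_rpow (by linarith) hp0.le]
      rw [show 1 - α + 1 = 2 - α by ring]
    have hj : ∫⁻ s, (Set.Ioi 1).indicator (fun s : ℝ => ENNReal.ofReal (s ^ (1 - m))) s =
        ENNReal.ofReal (1 / (m - 2)) := by
      rw [lintegral_indicator measurableSet_Ioi, lintegral_Ioi_rpow (by linarith) one_pos,
        Real.one_rpow, ← neg_div_neg_eq, neg_neg]
      congr 2; ring
    have hp2 : 0 ≤ p ^ (2 - α) / (2 - α) := div_nonneg (by positivity) (by linarith)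
    split_ifs with h
    · rw [lintegral_const_mul _ (by fun_prop)]
      simp only [add_zero]
      rw [hi, ← ENNReal.ofReal_mul hK.le]
    · rw [lintegral_const_mul _ (by fun_prop), lintegral_add_left hmi, hi, hj,
        ← ENNReal.ofReal_add hp2 (div_nonneg one_pos.le (by linarith)), ← ENNReal.ofReal_mul hK.le]
  rw [← ofReal_measureReal (μ := μ) (s := Set.univ), mul_assoc (μ.real Set.univ),
    ENNReal.ofReal_mul measureReal_nonneg]
  gcongr

end

/-! ### The polar Lévy measure: masses of balls and nondegeneracy -/

section

variable {d : ℕ} {α m γ K : ℝ}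
  {μ : Measure (Metric.sphere (0 : EuclideanSpace ℝ (Fin d)) 1)} [IsFiniteMeasure μ]
  {Q : Metric.sphere (0 : EuclideanSpace ℝ (Fin d)) 1 → ℝ → ℝ}

/-- Masses of balls under `polarMeasure μ Q`, if `μ` is a `(γ - 1)`-measure. -/
theorem polarMeasure_ball_inter_le {C : ℝ} (hα : 0 < α) (hαm : α ≤ m) (hK : 0 < K)
    (hμ : ∀ (θ : Metric.sphere (0 : EuclideanSpace ℝ (Fin d)) 1) (ρ : ℝ), 0 < ρ →
      μ (Metric.ball θ ρ) ≤ ENNReal.ofReal (C * ρ ^ (γ - 1)))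
    (hQ : Measurable (Function.uncurry Q)) (hL : IsLayered α m K Q)
    (w : EuclideanSpace ℝ (Fin d)) {ρ R : ℝ} (hρ : 0 < ρ) (hR : 0 < R) :
    polarMeasure μ Q (Metric.ball w ρ ∩ {y | R ≤ ‖y‖}) ≤
      ENNReal.ofReal (ρ ^ γ *
        (C * K * 4 ^ γ * 2 ^ (m - α) * (R ^ (-γ - α) * (1 + R) ^ (α - m)))) := by
  set U : Set (EuclideanSpace ℝ (Fin d)) := Metric.ball w ρ ∩ {y | R ≤ ‖y‖} with hU
  rw [polarMeasure_apply μ Q hQ _ (measurableSet_ball_inter_le_norm w ρ R)]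
  by_cases hex : ∃ (θ : Metric.sphere (0 : EuclideanSpace ℝ (Fin d)) 1) (s : ℝ),
      0 < s ∧ s • (θ : EuclideanSpace ℝ (Fin d)) ∈ U
  swap
  · push Not at hex
    refine le_trans (le_of_eq ?_) (zero_le)
    calc _ = ∫⁻ θ : Metric.sphere (0 : EuclideanSpace ℝ (Fin d)) 1,
          ∫⁻ s in Set.Ioi (0 : ℝ), 0 ∂volume ∂μ := by
          refine lintegral_congr fun θ => setLIntegral_congr_fun measurableSet_Ioi fun s hs => ?_
          exact Set.indicator_of_notMem (hex θ s hs) _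
      _ = 0 := by simp
  -- A point of the set replaces the centre w, which may lie near the origin: the other points of
  -- the set are within 2ρ of it, and s₀ ≥ R.
  obtain ⟨θ₀, s₀, hs₀, hmem₀⟩ := hex
  have hR₀ : R ≤ s₀ := by
    have := hmem₀.2
    rwa [Set.mem_ofPred_eq, norm_smul_sphere θ₀ hs₀] at this
  set V : ℝ := K * (2 ^ (m - α) * (R ^ (-α - 1) * (1 + R) ^ (α - m))) with hV
  have hV0 : 0 ≤ V := by positivity
  have hpt : ∀ (θ : Metric.sphere (0 : EuclideanSpace ℝ (Fin d)) 1) (s : ℝ), 0 < s →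
      U.indicator (fun _ => ENNReal.ofReal (Q θ s)) (s • (θ : EuclideanSpace ℝ (Fin d))) ≤
      (Metric.ball θ₀ (4 * ρ / R)).indicator (fun _ =>
        (Set.Ioo (s₀ - 2 * ρ) (s₀ + 2 * ρ)).indicator (fun _ => ENNReal.ofReal V) s) θ := by
    intro θ s hs
    by_cases hmem : s • (θ : EuclideanSpace ℝ (Fin d)) ∈ U
    swap
    · rw [Set.indicator_of_notMem hmem]
      exact zero_le
    have hRs : R ≤ s := by
      have := hmem.2
      rwa [Set.mem_ofPred_eq, norm_smul_sphere θ hs] at this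
    have hdist : ‖s • (θ : EuclideanSpace ℝ (Fin d)) - s₀ • (θ₀ : EuclideanSpace ℝ (Fin d))‖ <
        2 * ρ := by
      rw [← dist_eq_norm]
      have h1 := Metric.mem_ball.1 hmem.1
      have h2 := Metric.mem_ball.1 hmem₀.1
      have h3 := dist_triangle_right (s • (θ : EuclideanSpace ℝ (Fin d)))
        (s₀ • (θ₀ : EuclideanSpace ℝ (Fin d))) w
      linarith
    have hss : |s - s₀| < 2 * ρ := by
      have := abs_norm_sub_norm_le (s • (θ : EuclideanSpace ℝ (Fin d)))
        (s₀ • (θ₀ : EuclideanSpace ℝ (Fin d)))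
      rw [norm_smul_sphere θ hs, norm_smul_sphere θ₀ hs₀] at this
      linarith
    -- s₀|θ - θ₀| is at most |s - s₀| plus the distance of the two points, each below 2ρ.
    have hθ : θ ∈ Metric.ball θ₀ (4 * ρ / R) := by
      rw [Metric.mem_ball, Subtype.dist_eq, dist_eq_norm, lt_div_iff₀ hR]
      have h1 : s₀ • ((θ : EuclideanSpace ℝ (Fin d)) - θ₀) =
          (s₀ - s) • (θ : EuclideanSpace ℝ (Fin d)) + (s • (θ : EuclideanSpace ℝ (Fin d)) -
            s₀ • (θ₀ : EuclideanSpace ℝ (Fin d))) := by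
        rw [smul_sub, sub_smul]; abel
      have h2 : s₀ * ‖(θ : EuclideanSpace ℝ (Fin d)) - θ₀‖ < 4 * ρ := by
        rw [← abs_of_pos hs₀, ← Real.norm_eq_abs, ← norm_smul, h1]
        refine (norm_add_le _ _).trans_lt ?_
        rw [norm_smul, norm_eq_of_mem_sphere θ, mul_one, Real.norm_eq_abs, abs_sub_comm]
        linarith
      nlinarith [norm_nonneg ((θ : EuclideanSpace ℝ (Fin d)) - θ₀)]
    rw [Set.indicator_of_mem hmem, Set.indicator_of_mem hθ, Set.indicator_of_mem]
    · refine ENNReal.ofReal_le_ofReal ((hL θ s hs).2.trans ?_)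
      rw [hV]
      refine mul_le_mul_of_nonneg_left ((layeredProfile_le hαm hs).trans ?_) hK.le
      have h1 : s ^ (-α - 1) ≤ R ^ (-α - 1) :=
        Real.rpow_le_rpow_of_nonpos hR hRs (by linarith)
      have h2 : (1 + s) ^ (α - m) ≤ (1 + R) ^ (α - m) :=
        Real.rpow_le_rpow_of_nonpos (by linarith) (by linarith) (by linarith)
      gcongr
    · obtain ⟨h1, h2⟩ := abs_lt.1 hss
      exact ⟨by linarith, by linarith⟩
  calc _ ≤ ∫⁻ θ, ∫⁻ s in Set.Ioi (0 : ℝ), (Metric.ball θ₀ (4 * ρ / R)).indicator (fun _ =>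
        (Set.Ioo (s₀ - 2 * ρ) (s₀ + 2 * ρ)).indicator (fun _ => ENNReal.ofReal V) s) θ
          ∂volume ∂μ :=
        lintegral_mono fun θ => setLIntegral_mono' measurableSet_Ioi fun s hs => hpt θ s hs
    _ ≤ ∫⁻ θ, (Metric.ball θ₀ (4 * ρ / R)).indicator (fun _ =>
          ENNReal.ofReal V * ENNReal.ofReal (4 * ρ)) θ ∂μ := by
        refine lintegral_mono fun θ => ?_
        by_cases h : θ ∈ Metric.ball θ₀ (4 * ρ / R)
        · simp only [Set.indicator_of_mem h]
          refine (setLIntegral_le_lintegral _ _).trans ?_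
          rw [lintegral_indicator_const measurableSet_Ioo, Real.volume_Ioo]
          gcongr
          linarith
        · simp [Set.indicator_of_notMem h]
    _ = ENNReal.ofReal V * ENNReal.ofReal (4 * ρ) * μ (Metric.ball θ₀ (4 * ρ / R)) :=
        lintegral_indicator_const measurableSet_ball _
    _ ≤ ENNReal.ofReal V * ENNReal.ofReal (4 * ρ) *
          ENNReal.ofReal (C * (4 * ρ / R) ^ (γ - 1)) := by
        gcongr
        exact hμ θ₀ _ (by positivity)
    _ = _ := by
        rw [← ENNReal.ofReal_mul hV0, ← ENNReal.ofReal_mul (by positivity)]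
        congr 1
        -- Radial length ρ, angular mass (ρ/R)^{γ-1} and radial density R^{-α-1} combine to ρ^γ
        -- R^{-γ-α}.
        have h1 : 4 * ρ * (4 * ρ / R) ^ (γ - 1) * R ^ (-α - 1) =
            ρ ^ γ * 4 ^ γ * R ^ (-γ - α) := by
          rw [Real.div_rpow (by positivity) hR.le, div_eq_mul_inv, ← Real.rpow_neg hR.le]
          have h2 : 4 * ρ * (4 * ρ) ^ (γ - 1) = (4 * ρ) ^ γ := by
            rw [mul_comm, Real.rpow_sub_one (by positivity)]
            field_simp
          have h3 : R ^ (-(γ - 1)) * R ^ (-α - 1) = R ^ (-γ - α) := by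
            rw [← Real.rpow_add hR]; congr 1; ring
          rw [← mul_assoc, h2, mul_assoc, h3, Real.mul_rpow (by norm_num) hρ.le]
          ring
        calc V * (4 * ρ) * (C * (4 * ρ / R) ^ (γ - 1)) =
            K * 2 ^ (m - α) * (1 + R) ^ (α - m) * C *
              (4 * ρ * (4 * ρ / R) ^ (γ - 1) * R ^ (-α - 1)) := by rw [hV]; ring
          _ = _ := by rw [h1]; ring

/-- A nondegenerate measure on the sphere has a positive definite second moment form. -/
theorem SphereNondegenerate.exists_le_integral_inner_sq (hμ : SphereNondegenerate μ) :
    ∃ κ : ℝ, 0 < κ ∧ ∀ ξ : EuclideanSpace ℝ (Fin d),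
      κ * ‖ξ‖ ^ 2 ≤ ∫ θ, ⟪(θ : EuclideanSpace ℝ (Fin d)), ξ⟫ ^ 2 ∂μ := by
  set q : EuclideanSpace ℝ (Fin d) → ℝ :=
    fun ξ => ∫ θ, ⟪(θ : EuclideanSpace ℝ (Fin d)), ξ⟫ ^ 2 ∂μ with hq
  have hqc : Continuous q := by
    have := continuous_parametric_integral_of_continuous (μ := μ)
      (f := fun (ξ : EuclideanSpace ℝ (Fin d))
        (θ : Metric.sphere (0 : EuclideanSpace ℝ (Fin d)) 1) =>
          ⟪(θ : EuclideanSpace ℝ (Fin d)), ξ⟫ ^ 2) (by fun_prop) isCompact_univ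
    simpa using this
  have hint : ∀ ξ, Integrable (fun θ : Metric.sphere (0 : EuclideanSpace ℝ (Fin d)) 1 =>
      ⟪(θ : EuclideanSpace ℝ (Fin d)), ξ⟫ ^ 2) μ := fun ξ =>
    (by fun_prop : Continuous fun θ : Metric.sphere (0 : EuclideanSpace ℝ (Fin d)) 1 =>
      ⟪(θ : EuclideanSpace ℝ (Fin d)), ξ⟫ ^ 2).integrable_of_hasCompactSupport
      (HasCompactSupport.of_compactSpace _)
  have hpos : ∀ ξ, ξ ≠ 0 → 0 < q ξ := by
    intro ξ hξ
    refine lt_of_le_of_ne (integral_nonneg fun θ => sq_nonneg _) fun h0 => hξ ?_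
    have hae := (integral_eq_zero_iff_of_nonneg (fun θ => sq_nonneg _) (hint ξ)).1 h0.symm
    -- A vanishing second moment in direction ξ confines the support of μ to the hyperplane
    -- orthogonal to ξ, contrary to nondegeneracy.
    have hsub := Measure.support_subset_of_isClosed (μ := μ)
      (t := {θ | ⟪(θ : EuclideanSpace ℝ (Fin d)), ξ⟫ = 0})
      (isClosed_eq (by fun_prop) continuous_const) (by
        filter_upwards [hae] with θ hθ
        simpa using hθ)
    have htop := hμ (Submodule.span ℝ {ξ})ᗮ (by
      rintro _ ⟨θ, hθ, rfl⟩
      rw [SetLike.mem_coe, Submodule.mem_orthogonal_singleton_iff_inner_left]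
      exact hsub hθ)
    have hξ2 : ξ ∈ (Submodule.span ℝ {ξ})ᗮ := htop ▸ Submodule.mem_top
    rw [Submodule.mem_orthogonal_singleton_iff_inner_left] at hξ2
    exact inner_self_eq_zero.1 hξ2
  have hscale : ∀ ξ, ξ ≠ 0 → q ξ = ‖ξ‖ ^ 2 * q (‖ξ‖⁻¹ • ξ) := by
    intro ξ hξ
    have hn : ‖ξ‖ ≠ 0 := norm_ne_zero_iff.2 hξ
    simp only [hq, inner_smul_right, mul_pow, integral_const_mul]
    field_simp
  have hnorm : ∀ ξ : EuclideanSpace ℝ (Fin d), ξ ≠ 0 →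
      ‖ξ‖⁻¹ • ξ ∈ Metric.sphere (0 : EuclideanSpace ℝ (Fin d)) 1 := by
    intro ξ hξ
    simp [norm_smul, norm_ne_zero_iff.2 hξ]
  -- By homogeneity κ is the minimum over the unit sphere; an empty sphere leaves only ξ = 0.
  rcases (Metric.sphere (0 : EuclideanSpace ℝ (Fin d)) 1).eq_empty_or_nonempty with hS | hS
  · refine ⟨1, one_pos, fun ξ => ?_⟩
    by_cases hξ : ξ = 0
    · simp [hξ]
    · exact absurd (hnorm ξ hξ) (by simp [hS])
  · obtain ⟨e, he, hmin⟩ := (isCompact_sphere _ _).exists_isMinOn hS hqc.continuousOn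
    have he0 : e ≠ 0 := by
      rintro rfl
      simp at he
    refine ⟨q e, hpos e he0, fun ξ => ?_⟩
    by_cases hξ : ξ = 0
    · simp [hξ]
    · show _ ≤ q ξ
      rw [hscale ξ hξ, mul_comm]
      gcongr
      exact hmin (hnorm ξ hξ)

/-- Lower bound for the real part of the exponent. -/
theorem le_setLIntegral_one_sub_cos_polarMeasure (hα : α < 2) (hK : 0 < K)
    (hQ : Measurable (Function.uncurry Q)) (hL : IsLayered α m K Q) {κ : ℝ}
    (hκ : ∀ ξ : EuclideanSpace ℝ (Fin d),
      κ * ‖ξ‖ ^ 2 ≤ ∫ θ, ⟪(θ : EuclideanSpace ℝ (Fin d)), ξ⟫ ^ 2 ∂μ)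
    {r a : ℝ} (ha : 0 < a) (har : a < r) (ha1 : a ≤ 1) (ξ : EuclideanSpace ℝ (Fin d))
    (haξ : a * ‖ξ‖ ≤ 1) :
    ENNReal.ofReal (2 / Real.pi ^ 2 * K⁻¹ * (a ^ (2 - α) / (2 - α)) * (κ * ‖ξ‖ ^ 2)) ≤
      ∫⁻ y in Metric.ball 0 r, ENNReal.ofReal (1 - Real.cos ⟪y, ξ⟫) ∂polarMeasure μ Q := by
  have hK' : 0 < K⁻¹ := inv_pos.2 hK
  rw [← lintegral_indicator measurableSet_ball, lintegral_polarMeasure hQ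
    (Measurable.indicator (by fun_prop) measurableSet_ball)]
  have hin : ∀ θ : Metric.sphere (0 : EuclideanSpace ℝ (Fin d)) 1,
      ENNReal.ofReal (2 / Real.pi ^ 2 * K⁻¹ * (a ^ (2 - α) / (2 - α)) *
        ⟪(θ : EuclideanSpace ℝ (Fin d)), ξ⟫ ^ 2) ≤
      ∫⁻ s in Set.Ioi (0 : ℝ), (Metric.ball (0 : EuclideanSpace ℝ (Fin d)) r).indicator
        (fun y => ENNReal.ofReal (1 - Real.cos ⟪y, ξ⟫)) (s • (θ : EuclideanSpace ℝ (Fin d))) *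
          ENNReal.ofReal (Q θ s) := by
    intro θ
    set u : ℝ := ⟪(θ : EuclideanSpace ℝ (Fin d)), ξ⟫ with hu
    have hun : |u| ≤ ‖ξ‖ := by
      have := abs_real_inner_le_norm (θ : EuclideanSpace ℝ (Fin d)) ξ
      rwa [norm_eq_of_mem_sphere θ, one_mul] at this
    -- Only jumps s ≤ a are kept: there the profile is s^{-α-1}, and |s u| ≤ 1 allows 1 - cos z ≥
    -- 2z²/π².
    calc _ = ∫⁻ s in Set.Ioc 0 a, ENNReal.ofReal (2 / Real.pi ^ 2 * K⁻¹ * u ^ 2) *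
          ENNReal.ofReal (s ^ (1 - α)) := by
          rw [lintegral_const_mul _ (by fun_prop), lintegral_Ioc_zero_rpow (by linarith) ha.le,
            ← ENNReal.ofReal_mul (by positivity), show 1 - α + 1 = 2 - α by ring]
          congr 1
          ring
      _ ≤ ∫⁻ s in Set.Ioc 0 a, (Metric.ball (0 : EuclideanSpace ℝ (Fin d)) r).indicator
          (fun y => ENNReal.ofReal (1 - Real.cos ⟪y, ξ⟫)) (s • (θ : EuclideanSpace ℝ (Fin d))) *
            ENNReal.ofReal (Q θ s) := by
          refine setLIntegral_mono' measurableSet_Ioc fun s hs => ?_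
          have hs0 : 0 < s := hs.1
          have hball : s • (θ : EuclideanSpace ℝ (Fin d)) ∈
              Metric.ball (0 : EuclideanSpace ℝ (Fin d)) r := by
            rw [mem_ball_zero_iff, norm_smul_sphere θ hs0]
            exact hs.2.trans_lt har
          rw [Set.indicator_of_mem hball, real_inner_smul_left, ← hu]
          have hQs := (hL θ s hs0).1
          rw [layeredProfile, if_pos (hs.2.trans ha1)] at hQs
          have hsu : |s * u| ≤ Real.pi := by
            rw [abs_mul, abs_of_pos hs0]
            calc s * |u| ≤ a * ‖ξ‖ := by gcongr; exact hs.2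
              _ ≤ Real.pi := haξ.trans (by linarith [Real.pi_gt_three])
          have hcos := Real.cos_le_one_sub_mul_cos_sq hsu
          have hc0 : 0 ≤ 1 - Real.cos (s * u) := by linarith [Real.cos_le_one (s * u)]
          rw [← ENNReal.ofReal_mul (by positivity), ← ENNReal.ofReal_mul hc0]
          refine ENNReal.ofReal_le_ofReal ?_
          have hs2 : s ^ (1 - α) = s ^ 2 * s ^ (-α - 1) := by
            rw [← Real.rpow_natCast, ← Real.rpow_add hs0]; congr 1; push_cast; ring
          calc 2 / Real.pi ^ 2 * K⁻¹ * u ^ 2 * s ^ (1 - α) =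
              (2 / Real.pi ^ 2 * (s * u) ^ 2) * (K⁻¹ * s ^ (-α - 1)) := by rw [hs2]; ring
            _ ≤ (1 - Real.cos (s * u)) * Q θ s := by
              refine mul_le_mul (by linarith) hQs (by positivity) hc0
      _ ≤ _ := lintegral_mono_set Set.Ioc_subset_Ioi_self
  refine le_trans ?_ (lintegral_mono hin)
  have ha2 : 0 ≤ a ^ (2 - α) / (2 - α) := div_nonneg (by positivity) (by linarith)
  have hint : Integrable (fun θ : Metric.sphere (0 : EuclideanSpace ℝ (Fin d)) 1 =>
      ⟪(θ : EuclideanSpace ℝ (Fin d)), ξ⟫ ^ 2) μ :=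
    (by fun_prop : Continuous fun θ : Metric.sphere (0 : EuclideanSpace ℝ (Fin d)) 1 =>
      ⟪(θ : EuclideanSpace ℝ (Fin d)), ξ⟫ ^ 2).integrable_of_hasCompactSupport
      (HasCompactSupport.of_compactSpace _)
  rw [← ofReal_integral_eq_lintegral_ofReal (hint.const_mul _)
    (ae_of_all _ fun θ => by positivity), integral_const_mul]
  gcongr
  exact hκ ξ

end

/-! ### Change of truncation radius and the layered density at scale r -/

section

variable {d : ℕ}

theorem setIntegral_annulus {ν : Measure (EuclideanSpace ℝ (Fin d))} {p q : ℝ}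
    (h0 : ν {y | ‖y‖ = p} = 0) :
    ∫ y in {y | p < ‖y‖ ∧ ‖y‖ < q}, y ∂ν = ∫ y in Metric.ball 0 q \ Metric.ball 0 p, y ∂ν := by
  refine setIntegral_congr_set ?_
  have hne : ∀ᵐ y ∂ν, ‖y‖ ≠ p := by
    rw [ae_iff]
    simpa using h0
  filter_upwards [hne] with y hy
  refine propext ⟨fun h => ⟨by simpa using h.2, by simpa using h.1.le⟩, fun h => ⟨?_, ?_⟩⟩
  · have : p ≤ ‖y‖ := by simpa using h.2
    exact lt_of_le_of_ne this (Ne.symm hy)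
  · simpa using h.1

theorem integrableOn_annulus {ν : Measure (EuclideanSpace ℝ (Fin d))} {p : ℝ} (q : ℝ)
    (hfin : ν (Metric.ball 0 p)ᶜ ≠ ∞) :
    IntegrableOn (fun y => y) (Metric.ball 0 q \ Metric.ball 0 p) ν := by
  have hm : MeasurableSet (Metric.ball (0 : EuclideanSpace ℝ (Fin d)) q \ Metric.ball 0 p) :=
    measurableSet_ball.diff measurableSet_ball
  refine Measure.integrableOn_of_bounded (M := q) (s_finite :=
    measure_ne_top_of_subset (fun y hy => hy.2) hfin) (by fun_prop) ?_
  exact ae_restrict_of_forall_mem hm fun y hy => (mem_ball_zero_iff.1 hy.1).le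

/-- The compensation in `levyExponent` can be done on any ball, with the drift `levyDrift`. -/
theorem neg_levyExponent_eq {ν : Measure (EuclideanSpace ℝ (Fin d))}
    (hsq : ∀ r, 0 < r → IntegrableOn (fun y => ‖y‖ ^ 2) (Metric.ball 0 r) ν)
    (hfin : ∀ r, 0 < r → ν (Metric.ball 0 r)ᶜ ≠ ∞) (h0 : ∀ c : ℝ, ν {y | ‖y‖ = c} = 0)
    (b ξ : EuclideanSpace ℝ (Fin d)) {r : ℝ} (hr : 0 < r) :
    -levyExponent ν b ξ = (∫ y in Metric.ball 0 r, compensatedExp ξ y ∂ν) +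
      (∫ y in (Metric.ball 0 r)ᶜ, (Complex.exp (⟪y, ξ⟫ * Complex.I) - 1) ∂ν) +
      ⟪levyDrift ν b r, ξ⟫ * Complex.I := by
  -- The difference of the two compensators. It is supported in the annulus between radii 1 and r,
  -- away from the origin, so it is integrable and becomes drift.
  set D : EuclideanSpace ℝ (Fin d) → EuclideanSpace ℝ (Fin d) := fun y =>
    (Metric.ball 0 r).indicator (fun y => y) y - (Metric.ball 0 1).indicator (fun y => y) y with hD
  have hdiff : ∀ p q : ℝ, p ≤ q → ∀ y : EuclideanSpace ℝ (Fin d),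
      (Metric.ball 0 q).indicator (fun y => y) y - (Metric.ball 0 p).indicator (fun y => y) y =
        (Metric.ball 0 q \ Metric.ball 0 p).indicator (fun y => y) y := by
    intro p q hpq y
    have hsub : Metric.ball (0 : EuclideanSpace ℝ (Fin d)) p ⊆ Metric.ball 0 q :=
      Metric.ball_subset_ball hpq
    by_cases hp : y ∈ Metric.ball (0 : EuclideanSpace ℝ (Fin d)) p
    · simp [hp, hsub hp]
    · by_cases hq : y ∈ Metric.ball (0 : EuclideanSpace ℝ (Fin d)) q <;> simp [hp, hq]
  have hDint : Integrable D ν ∧ levyDrift ν b r = b + ∫ y, D y ∂ν := by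
    have hm : ∀ p q : ℝ,
        MeasurableSet (Metric.ball (0 : EuclideanSpace ℝ (Fin d)) q \ Metric.ball 0 p) :=
      fun p q => measurableSet_ball.diff measurableSet_ball
    rcases le_or_gt r 1 with h | h
    · have hDe : D = fun y => -((Metric.ball 0 1 \ Metric.ball 0 r).indicator (fun y => y) y) := by
        ext1 y
        rw [← hdiff r 1 h, neg_sub]
      have hi := (integrable_indicator_iff (hm r 1)).2 (integrableOn_annulus 1 (hfin r hr))
      refine ⟨by rw [hDe]; exact hi.neg, ?_⟩
      rw [levyDrift, if_pos h, hDe, integral_neg, integral_indicator (hm r 1),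
        setIntegral_annulus (h0 r), sub_eq_add_neg]
    · have hDe : D = (Metric.ball 0 r \ Metric.ball 0 1).indicator (fun y => y) := by
        ext1 y
        rw [← hdiff 1 r h.le]
      have hi := (integrable_indicator_iff (hm 1 r)).2 (integrableOn_annulus r (hfin 1 one_pos))
      refine ⟨by rw [hDe]; exact hi, ?_⟩
      rw [levyDrift, if_neg (not_le.2 h), hDe, integral_indicator (hm 1 r),
        setIntegral_annulus (h0 1)]
  obtain ⟨hDi, hdrift⟩ := hDint
  have hpt : ∀ y, Complex.exp (Complex.I * (⟪ξ, y⟫ : ℝ)) - 1 -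
      (Metric.ball (0 : EuclideanSpace ℝ (Fin d)) 1).indicator
        (fun z => Complex.I * ((⟪ξ, z⟫ : ℝ) : ℂ)) y =
      (Metric.ball 0 r).indicator (compensatedExp ξ) y +
      (Metric.ball 0 r)ᶜ.indicator (fun y => Complex.exp (⟪y, ξ⟫ * Complex.I) - 1) y +
      (⟪D y, ξ⟫ : ℝ) * Complex.I := by
    intro y
    rw [real_inner_comm, mul_comm Complex.I]
    simp only [hD, inner_sub_left]
    by_cases h1 : y ∈ Metric.ball (0 : EuclideanSpace ℝ (Fin d)) 1 <;>
    by_cases h2 : y ∈ Metric.ball (0 : EuclideanSpace ℝ (Fin d)) r <;>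
    simp only [h1, h2, Set.indicator_of_mem, Set.indicator_of_notMem, Set.mem_compl_iff,
      not_true_eq_false, not_false_eq_true, compensatedExp, real_inner_comm ξ y, inner_zero_left] <;>
    push_cast <;> ring
  have hi1 : Integrable ((Metric.ball 0 r).indicator (compensatedExp ξ)) ν :=
    (integrable_indicator_iff measurableSet_ball).2 (integrable_compensatedExp (hsq r hr) ξ)
  have hi2 : Integrable ((Metric.ball 0 r)ᶜ.indicator
      (fun y => Complex.exp (⟪y, ξ⟫ * Complex.I) - 1)) ν := by
    refine (integrable_indicator_iff measurableSet_ball.compl).2 ?_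
    refine Measure.integrableOn_of_bounded (M := 2) (s_finite := hfin r hr) (by fun_prop)
      (ae_of_all _ fun y => ?_)
    refine (norm_sub_le _ _).trans ?_
    rw [Complex.norm_exp_ofReal_mul_I]
    norm_num
  have hi3 : Integrable (fun y => ((⟪D y, ξ⟫ : ℝ) : ℂ) * Complex.I) ν :=
    (hDi.inner_const ξ).ofReal.mul_const _
  have h3 : ∫ y, (⟪D y, ξ⟫ : ℝ) ∂ν = ⟪∫ y, D y ∂ν, ξ⟫ := by
    simp_rw [real_inner_comm ξ]
    exact integral_inner hDi ξ
  have hi12 : Integrable (fun y => (Metric.ball 0 r).indicator (compensatedExp ξ) y +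
      (Metric.ball 0 r)ᶜ.indicator (fun y => Complex.exp (⟪y, ξ⟫ * Complex.I) - 1) y) ν :=
    hi1.add hi2
  rw [levyExponent]
  simp_rw [hpt]
  rw [integral_add hi12 hi3, integral_add hi1 hi2, integral_indicator measurableSet_ball,
    integral_indicator measurableSet_ball.compl, integral_mul_const, integral_complex_ofReal, h3,
    hdrift, inner_add_left, real_inner_comm b ξ]
  push_cast
  ring

/-- The bound for the masses of balls at distance `R` from the origin. -/
noncomputable def ballTail (α m γ C r R : ℝ) : ℝ :=
  C * (max R r ^ (-γ - α) * (1 + max R r) ^ (α - m))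

/-- Halving R at most halves max R r, so each negative power costs at most its power of 2, and (γ +
α) + (m - α) = γ + m. -/
theorem ballTail_nonneg_and_half_le {α m γ C r : ℝ} (hα : 0 < α) (hm : α ≤ m) (hγ : 0 ≤ γ)
    (hC : 0 ≤ C) (hr : 0 < r) (R : ℝ) :
    0 ≤ ballTail α m γ C r R ∧ ballTail α m γ C r (R / 2) ≤ 2 ^ (γ + m) * ballTail α m γ C r R := by
  set M := max R r with hM
  have hM0 : 0 < M := lt_max_of_lt_right hr
  have hM2 : M / 2 ≤ max (R / 2) r := by
    rw [div_le_iff₀ two_pos, hM]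
    refine max_le ?_ ?_
    · linarith [le_max_left (R / 2) r]
    · linarith [le_max_right (R / 2) r]
  refine ⟨by unfold ballTail; positivity, ?_⟩
  have h1 : max (R / 2) r ^ (-γ - α) ≤ 2 ^ (γ + α) * M ^ (-γ - α) := by
    calc max (R / 2) r ^ (-γ - α) ≤ (M / 2) ^ (-γ - α) :=
          Real.rpow_le_rpow_of_nonpos (by positivity) hM2 (by linarith)
      _ = _ := by
          rw [Real.div_rpow hM0.le two_pos.le, div_eq_mul_inv, ← Real.rpow_neg two_pos.le, mul_comm]
          congr 2
          ring
  have h2 : (1 + max (R / 2) r) ^ (α - m) ≤ 2 ^ (m - α) * (1 + M) ^ (α - m) := by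
    calc (1 + max (R / 2) r) ^ (α - m) ≤ ((1 + M) / 2) ^ (α - m) :=
          Real.rpow_le_rpow_of_nonpos (by positivity) (by linarith) (by linarith)
      _ = _ := by
          rw [Real.div_rpow (by positivity) two_pos.le, div_eq_mul_inv, ← Real.rpow_neg two_pos.le,
            mul_comm]
          congr 2
          ring
  have h3 : (2 : ℝ) ^ (γ + m) = 2 ^ (γ + α) * 2 ^ (m - α) := by
    rw [← Real.rpow_add two_pos]; congr 1; ring
  unfold ballTail
  rw [h3, ← hM]
  calc _ ≤ C * ((2 ^ (γ + α) * M ^ (-γ - α)) * (2 ^ (m - α) * (1 + M) ^ (α - m))) := by gcongr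
    _ = _ := by ring

/-- Density estimates for layered stable semigroups at time `t`, in terms of the scale `r`. -/
theorem exists_layered_density {α m γ K : ℝ} (hα : α ∈ Set.Ioo (0 : ℝ) 2) (hm : 2 < m)
    (hγ : 1 ≤ γ) (hK : 0 < K)
    (μ : Measure (Metric.sphere (0 : EuclideanSpace ℝ (Fin d)) 1)) [IsFiniteMeasure μ]
    (hμ : SphereNondegenerate μ) (hμγ : IsSphereDimMeasure (γ - 1) μ) :
    ∃ B c C : ℝ, 0 < B ∧ 0 < c ∧ 0 ≤ C ∧
      ∀ Q : Metric.sphere (0 : EuclideanSpace ℝ (Fin d)) 1 → ℝ → ℝ,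
        Measurable (Function.uncurry Q) → IsLayered α m K Q →
        ∀ (b : EuclideanSpace ℝ (Fin d)) (t r : ℝ), 0 < r →
          ((r ≤ 1 ∧ t = r ^ α) ∨ (1 < r ∧ t = r ^ 2)) →
          ∃ (P : Measure (EuclideanSpace ℝ (Fin d))) (p : EuclideanSpace ℝ (Fin d) → ℝ),
            IsProbabilityMeasure P ∧
            (∀ ξ, charFun P ξ = Complex.exp (-(t : ℂ) * levyExponent (polarMeasure μ Q) b ξ)) ∧
            Continuous p ∧ (∀ x, 0 ≤ p x) ∧
            P = volume.withDensity (fun x => ENNReal.ofReal (p x)) ∧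
            (∀ x, p x ≤ B * (r ^ d)⁻¹) ∧
            ∀ x, p (x + t • levyDrift (polarMeasure μ Q) b r) ≤ B * (r ^ d)⁻¹ *
              (Real.exp (-c * (‖x‖ / r) * Real.log (1 + ‖x‖ / 2 / r)) +
                r ^ γ * ballTail α m γ (t * C) r ‖x‖) := by
  obtain ⟨hα0, hα2⟩ := hα
  obtain ⟨C₀, hC₀⟩ := hμγ
  obtain ⟨κ, hκ0, hκ⟩ := hμ.exists_le_integral_inner_sq
  set W : ℝ := μ.real Set.univ * K with hW
  have hW0 : 0 ≤ W := mul_nonneg measureReal_nonneg hK.le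
  have hK' : 0 < K⁻¹ := inv_pos.2 hK
  have hα2' : 0 < 2 - α := by linarith
  have hm2' : 0 < m - 2 := by linarith
  set c₀ : ℝ := 2 / Real.pi ^ 2 * K⁻¹ * κ / (2 - α) with hc₀
  have hc₀0 : 0 < c₀ := by positivity
  set A : ℝ := W * (1 / (2 - α) + 1 / (m - 2)) with hA
  have hA0 : 0 ≤ A := by positivity
  have hm0 : 0 < m := by linarith
  set L : ℝ := W * (1 / α + 1 / m) with hL
  have hL0 : 0 ≤ L := by positivity
  obtain ⟨B, c, hB, hc, hest⟩ := exists_density_estimate (EuclideanSpace ℝ (Fin d)) (γ := γ)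
    (D := 2 ^ (γ + m)) hα0 hc₀0 hA0 hL0 (Real.one_le_rpow one_le_two (by linarith)) (by linarith)
  set C : ℝ := |C₀| * K * 4 ^ γ * 2 ^ (m - α) with hC
  have hC0 : 0 ≤ C := by positivity
  refine ⟨B, c, C, hB, hc, hC0, fun Q hQ hlay b t r hr hrt => ?_⟩
  set ν := polarMeasure μ Q with hν
  have hball : ∀ s, 0 < s → ν (Metric.ball 0 s)ᶜ ≠ ∞ := fun s hs =>
    ((polarMeasure_compl_ball_le hK hQ hlay hs hα0
      fun s hs => layeredProfile_le_left (by linarith) s).trans_lt ENNReal.ofReal_lt_top).ne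
  have hsq : ∀ s, 0 < s → IntegrableOn (fun y => ‖y‖ ^ 2) (Metric.ball 0 s) ν := fun s hs =>
    (lintegral_ofReal_ne_top_iff_integrable (by fun_prop) (ae_of_all _ fun y => by positivity)).1
      ((setLIntegral_ball_sq_polarMeasure_le ⟨hα0, hα2⟩ hm hK hQ hlay hs).trans_lt
        ENNReal.ofReal_lt_top).ne
  have ht : 0 < t := by
    rcases hrt with ⟨-, rfl⟩ | ⟨-, rfl⟩ <;> positivity
  have hres : ∀ U : Set (EuclideanSpace ℝ (Fin d)),
      (ENNReal.ofReal t • ν).restrict U = ENNReal.ofReal t • ν.restrict U :=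
    fun U => Measure.restrict_smul _ _ _
  refine Exists.elim (hest (ENNReal.ofReal t • ν) r (ballTail α m γ (t * C) r) hr
    ?_ ?_ ?_ ?_ ?_ ?_ (t • levyDrift ν b r)) fun P hPp => ?_
  rotate_right
  · obtain ⟨p, hP, hchar, hpc, hp0, hpd, hpb, hpe⟩ := hPp
    rw [finrank_euclideanSpace_fin] at hpb hpe
    refine ⟨P, p, hP, fun ξ => ?_, hpc, hp0, hpd, hpb, hpe⟩
    rw [hchar, hres, hres, integral_smul_measure, integral_smul_measure,
      ENNReal.toReal_ofReal ht.le, neg_mul, ← mul_neg,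
      neg_levyExponent_eq hsq hball (polarMeasure_norm_eq hQ) b ξ hr, real_inner_smul_left]
    simp only [Complex.real_smul]
    congr 1
    push_cast
    ring
  · rw [IntegrableOn, hres]
    exact (hsq r hr).smul_measure ENNReal.ofReal_ne_top
  · rw [hres, integral_smul_measure, ENNReal.toReal_ofReal ht.le, smul_eq_mul]
    have h1 : ∫ y in Metric.ball 0 r, ‖y‖ ^ 2 ∂ν ≤
        W * (min 1 r ^ (2 - α) / (2 - α) + (if r ≤ 1 then 0 else 1 / (m - 2))) := by
      have h2 : 0 ≤ W * (min 1 r ^ (2 - α) / (2 - α) + (if r ≤ 1 then 0 else 1 / (m - 2))) := by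
        have : (0 : ℝ) ≤ if r ≤ 1 then 0 else 1 / (m - 2) := by split_ifs <;> positivity
        have h3 : (0 : ℝ) < min 1 r := lt_min one_pos hr
        positivity
      rw [← ENNReal.ofReal_le_ofReal_iff h2, ofReal_integral_eq_lintegral_ofReal (hsq r hr)
        (ae_of_all _ fun y => by positivity)]
      exact setLIntegral_ball_sq_polarMeasure_le ⟨hα0, hα2⟩ hm hK hQ hlay hr
    have hn : (0 : ℝ) ≤ 1 / (m - 2) := by positivity
    rcases hrt with ⟨hr1, rfl⟩ | ⟨hr1, rfl⟩
    · rw [min_eq_right hr1, if_pos hr1, add_zero] at h1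
      have h4 : r ^ α * r ^ (2 - α) = r ^ 2 := by
        rw [← Real.rpow_add hr, add_sub_cancel, ← Real.rpow_natCast]; norm_num
      calc _ ≤ r ^ α * (W * (r ^ (2 - α) / (2 - α))) := by gcongr
        _ = W * (1 / (2 - α)) * (r ^ α * r ^ (2 - α)) := by ring
        _ ≤ A * r ^ 2 := by
          rw [h4, hA]
          gcongr
          linarith
    · rw [min_eq_left hr1.le, if_neg (not_le.2 hr1), Real.one_rpow] at h1
      calc _ ≤ r ^ 2 * (W * (1 / (2 - α) + 1 / (m - 2))) := by gcongr
        _ = _ := by rw [hA]; ring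
  · intro ξ
    rw [hres, integral_smul_measure, ENNReal.toReal_ofReal ht.le, smul_eq_mul]
    have hnn : ∀ y : EuclideanSpace ℝ (Fin d), 0 ≤ 1 - Real.cos ⟪y, ξ⟫ := fun y => by
      linarith [Real.cos_le_one ⟪y, ξ⟫]
    have hI0 : 0 ≤ ∫ y in Metric.ball 0 r, (1 - Real.cos ⟪y, ξ⟫) ∂ν := integral_nonneg hnn
    -- For r|ξ| ≤ 1 the left side is nonpositive; this is what the -1 is for.
    rcases le_or_gt (r * ‖ξ‖) 1 with h1 | h1
    · have h2 : (r * ‖ξ‖) ^ α ≤ 1 := Real.rpow_le_one (by positivity) h1 hα0.le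
      have h3 : c₀ * ((r * ‖ξ‖) ^ α - 1) ≤ 0 :=
        mul_nonpos_of_nonneg_of_nonpos hc₀0.le (by linarith)
      exact h3.trans (by positivity)
    have hξ : 0 < ‖ξ‖ := by
      by_contra h
      nlinarith [norm_nonneg ξ]
    have hint : IntegrableOn (fun y => 1 - Real.cos ⟪y, ξ⟫) (Metric.ball 0 r) ν := by
      refine (integrable_compensatedExp (hsq r hr) ξ).re.neg.congr (ae_of_all _ fun y => ?_)
      simp [compensatedExp, Complex.exp_ofReal_mul_I_re]
    -- The cutoff a is 1/|ξ| when this is at most 1, giving |ξ|^α. When r > 1 and |ξ| ≤ 1, a = 1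
    -- gives the Gaussian order |ξ|², and (r|ξ|)² ≥ (r|ξ|)^α since r|ξ| > 1.
    have key : ∀ a, 0 < a → a < r → a ≤ 1 → a * ‖ξ‖ ≤ 1 →
        c₀ * (a ^ (2 - α) * ‖ξ‖ ^ 2) ≤ ∫ y in Metric.ball 0 r, (1 - Real.cos ⟪y, ξ⟫) ∂ν := by
      intro a ha har ha1 haξ
      rw [← ENNReal.ofReal_le_ofReal_iff hI0, ofReal_integral_eq_lintegral_ofReal hint
        (ae_of_all _ hnn)]
      refine le_trans (le_of_eq ?_)
        (le_setLIntegral_one_sub_cos_polarMeasure hα2 hK hQ hlay hκ ha har ha1 ξ haξ)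
      congr 1
      rw [hc₀]
      ring
    have hinv : ‖ξ‖⁻¹ ^ (2 - α) * ‖ξ‖ ^ 2 = ‖ξ‖ ^ α := by
      rw [Real.inv_rpow hξ.le, ← Real.rpow_neg hξ.le, ← Real.rpow_natCast ‖ξ‖ 2,
        ← Real.rpow_add hξ]
      congr 1
      push_cast
      ring
    have hξr : ‖ξ‖⁻¹ < r := by rwa [inv_lt_iff_one_lt_mul₀ hξ]
    have hξξ : ‖ξ‖⁻¹ * ‖ξ‖ ≤ 1 := (inv_mul_cancel₀ hξ.ne').le
    rcases hrt with ⟨hr1, rfl⟩ | ⟨hr1, rfl⟩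
    · have h2 := key ‖ξ‖⁻¹ (by positivity) hξr (hξr.le.trans hr1) hξξ
      rw [hinv] at h2
      calc c₀ * ((r * ‖ξ‖) ^ α - 1) ≤ c₀ * (r * ‖ξ‖) ^ α := by gcongr; linarith
        _ = r ^ α * (c₀ * ‖ξ‖ ^ α) := by rw [Real.mul_rpow hr.le hξ.le]; ring
        _ ≤ _ := by gcongr
    · have hsq2 : (r * ‖ξ‖) ^ α ≤ (r * ‖ξ‖) ^ 2 := by
        rw [← Real.rpow_natCast]
        exact Real.rpow_le_rpow_of_exponent_le h1.le (by push_cast; linarith)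
      have hra : r ^ α ≤ r ^ 2 := by
        rw [← Real.rpow_natCast]
        exact Real.rpow_le_rpow_of_exponent_le hr1.le (by push_cast; linarith)
      rcases le_total ‖ξ‖ 1 with h3 | h3
      · have h2 := key 1 one_pos hr1 le_rfl (by linarith)
        rw [Real.one_rpow, one_mul] at h2
        calc c₀ * ((r * ‖ξ‖) ^ α - 1) ≤ c₀ * (r * ‖ξ‖) ^ 2 := by gcongr; linarith
          _ = r ^ 2 * (c₀ * ‖ξ‖ ^ 2) := by ring
          _ ≤ _ := by gcongr
      · have h2 := key ‖ξ‖⁻¹ (by positivity) hξr (inv_le_one_of_one_le₀ h3) hξξ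
        rw [hinv] at h2
        calc c₀ * ((r * ‖ξ‖) ^ α - 1) ≤ c₀ * (r * ‖ξ‖) ^ α := by gcongr; linarith
          _ = r ^ α * (c₀ * ‖ξ‖ ^ α) := by rw [Real.mul_rpow hr.le hξ.le]; ring
          _ ≤ r ^ 2 * (c₀ * ‖ξ‖ ^ α) := by gcongr
          _ ≤ _ := by gcongr
  · rw [Measure.smul_apply, smul_eq_mul]
    have hn1 : (0 : ℝ) ≤ 1 / α := by positivity
    have hn2 : (0 : ℝ) ≤ 1 / m := by positivity
    rcases hrt with ⟨hr1, rfl⟩ | ⟨hr1, rfl⟩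
    · refine (mul_le_mul_right (polarMeasure_compl_ball_le hK hQ hlay hr hα0
        fun s hs => layeredProfile_le_left (by linarith) s) _).trans ?_
      rw [← ENNReal.ofReal_mul ht.le]
      refine ENNReal.ofReal_le_ofReal ?_
      have h1 : r ^ α * r ^ (-α) = 1 := by rw [← Real.rpow_add hr, add_neg_cancel, Real.rpow_zero]
      calc r ^ α * (W * (r ^ (-α) / α)) = W * (1 / α) * (r ^ α * r ^ (-α)) := by ring
        _ ≤ L := by
          rw [h1, mul_one, hL]
          gcongr
          linarith
    · refine (mul_le_mul_right (polarMeasure_compl_ball_le hK hQ hlay hr hm0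
        fun s hs => layeredProfile_le_right (by linarith) hs) _).trans ?_
      rw [← ENNReal.ofReal_mul ht.le]
      refine ENNReal.ofReal_le_ofReal ?_
      -- Since m > 2, the number of jumps beyond √t in time t stays bounded in mean.
      have h1 : r ^ 2 * r ^ (-m) ≤ 1 := by
        rw [← Real.rpow_natCast, ← Real.rpow_add hr]
        exact Real.rpow_le_one_of_one_le_of_nonpos hr1.le (by push_cast; linarith)
      calc r ^ 2 * (W * (r ^ (-m) / m)) = W * (1 / m) * (r ^ 2 * r ^ (-m)) := by ring
        _ ≤ W * (1 / m) * 1 := by gcongr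
        _ ≤ L := by
          rw [mul_one, hL]
          gcongr
          linarith
  · exact fun R _ => ballTail_nonneg_and_half_le hα0 (by linarith) (by linarith)
      (by positivity) hr R
  · intro w ρ R hρ _
    -- The large jumps have size at least r, so R may be replaced by max R r; this keeps the bound
    -- finite down to R = 0.
    have hset : (Metric.ball (0 : EuclideanSpace ℝ (Fin d)) r)ᶜ ∩
        (Metric.ball w ρ ∩ {y | R ≤ ‖y‖}) = Metric.ball w ρ ∩ {y | max R r ≤ ‖y‖} := by
      ext y
      simp
      tauto
    rw [hset, Measure.smul_apply, smul_eq_mul]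
    refine (mul_le_mul_right (polarMeasure_ball_inter_le (γ := γ) (C := |C₀|) hα0 (by linarith) hK
      (fun θ ρ hρ => (hC₀ θ ρ hρ).trans ?_) hQ hlay w hρ (lt_max_of_lt_right hr)) _).trans ?_
    · gcongr
      exact le_abs_self _
    · rw [← ENNReal.ofReal_mul ht.le]
      refine ENNReal.ofReal_le_ofReal (le_of_eq ?_)
      rw [ballTail]
      ring

end

/-! ### Comparison of the error terms and construction of the semigroup -/

section

variable {d : ℕ}

/-- For v ≥ 2 the logarithm is at least log 2 and the decay is exponential; the factor e^{2c log 2}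
covers v ≤ 2. -/
theorem exists_exp_neg_mul_log_le {c N : ℝ} (hc : 0 < c) (hN : 0 ≤ N) :
    ∃ C : ℝ, 0 < C ∧ ∀ v : ℝ, 0 ≤ v →
      Real.exp (-c * v * Real.log (1 + v / 2)) ≤ C * (1 + v) ^ (-N) := by
  have hl : 0 < Real.log 2 := Real.log_pos one_lt_two
  obtain ⟨C, hC, h⟩ := exists_exp_neg_rpow_le (α := 1) (c := c * Real.log 2) one_pos
    (by positivity) hN
  refine ⟨Real.exp (2 * (c * Real.log 2)) * C, by positivity, fun v hv => ?_⟩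
  rw [mul_assoc (Real.exp _)]
  refine le_trans ?_ (mul_le_mul_of_nonneg_left (h v hv) (Real.exp_pos _).le)
  rw [← Real.exp_add, Real.exp_le_exp, Real.rpow_one]
  rcases le_total v 2 with h2 | h2
  · have h1 : 0 ≤ Real.log (1 + v / 2) := Real.log_nonneg (by linarith)
    have h3 : 0 ≤ c * v * Real.log (1 + v / 2) := by positivity
    have h4 : 0 ≤ (c * Real.log 2) * (2 - v) := mul_nonneg (by positivity) (by linarith)
    linarith
  · have h1 : Real.log 2 ≤ Real.log (1 + v / 2) := Real.log_le_log two_pos (by linarith)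
    have h3 : c * v * Real.log 2 ≤ c * v * Real.log (1 + v / 2) :=
      mul_le_mul_of_nonneg_left h1 (by positivity)
    have h4 : 0 ≤ c * Real.log 2 := by positivity
    linarith

/-- The powers are decreasing, so max R r may be lowered to R, and r^γ t = t^{1+γ/β}. Both regimes
are covered, with β = α and β = 2. -/
theorem rpow_mul_ballTail_le {α m γ β C t r R : ℝ} (hα : 0 < α) (hm : α ≤ m) (hγ : 0 ≤ γ)
    (hC : 0 ≤ C) (ht : 0 < t) (hr : r = t ^ (1 / β)) (hR : 0 < R) :
    r ^ γ * ballTail α m γ (t * C) r R ≤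
      C * (t ^ (1 + γ / β) * R ^ (-γ - α) * (1 + R) ^ (α - m)) := by
  have hM : R ≤ max R r := le_max_left _ _
  have h1 : max R r ^ (-γ - α) ≤ R ^ (-γ - α) :=
    Real.rpow_le_rpow_of_nonpos hR hM (by linarith)
  have h2 : (1 + max R r) ^ (α - m) ≤ (1 + R) ^ (α - m) :=
    Real.rpow_le_rpow_of_nonpos (by linarith) (by linarith) (by linarith)
  have h3 : r ^ γ * t = t ^ (1 + γ / β) := by
    rw [hr, ← Real.rpow_mul ht.le, Real.rpow_add ht, Real.rpow_one, mul_comm]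
    congr 2
    ring
  have hr0 : 0 < r := hr ▸ Real.rpow_pos_of_pos ht _
  have hM0 : 0 < max R r := hR.trans_le hM
  calc r ^ γ * ballTail α m γ (t * C) r R
      = C * (r ^ γ * t) * (max R r ^ (-γ - α) * (1 + max R r) ^ (α - m)) := by
        unfold ballTail
        ring
    _ ≤ C * (r ^ γ * t) * (R ^ (-γ - α) * (1 + R) ^ (α - m)) := by gcongr
    _ = _ := by
        rw [h3]
        ring

/-- This is why no exponential term appears for t ≤ 1: r^{γ+α} = t^{1+γ/α} by scaling, and r ≤ 1
lets 1 + R/r be replaced by 1 + R in the remaining negative power. -/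
theorem one_add_div_rpow_neg_le {α m γ t r R : ℝ} (hα : 0 < α) (hm : α ≤ m) (hγ : 0 ≤ γ)
    (ht : 0 < t) (hr : r = t ^ (1 / α)) (hr1 : r ≤ 1) (hR : 0 < R) :
    (1 + R / r) ^ (-(γ + m)) ≤ t ^ (1 + γ / α) * R ^ (-γ - α) * (1 + R) ^ (α - m) := by
  have hr0 : 0 < r := hr ▸ Real.rpow_pos_of_pos ht _
  have hv : 0 < R / r := by positivity
  have hRv : R ≤ R / r := (le_div_iff₀ hr0).2 (mul_le_of_le_one_right hR.le hr1)
  have h1 : (1 + R / r) ^ (-γ - α) ≤ (R / r) ^ (-γ - α) :=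
    Real.rpow_le_rpow_of_nonpos hv (by linarith) (by linarith)
  have h2 : (1 + R / r) ^ (α - m) ≤ (1 + R) ^ (α - m) :=
    Real.rpow_le_rpow_of_nonpos (by linarith) (by linarith) (by linarith)
  have h3 : (R / r) ^ (-γ - α) = t ^ (1 + γ / α) * R ^ (-γ - α) := by
    rw [Real.div_rpow hR.le hr0.le, div_eq_mul_inv, ← Real.rpow_neg hr0.le, hr,
      ← Real.rpow_mul ht.le, mul_comm]
    congr 2
    field_simp
    ring
  calc (1 + R / r) ^ (-(γ + m)) = (1 + R / r) ^ (-γ - α) * (1 + R / r) ^ (α - m) := by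
        rw [← Real.rpow_add (by positivity)]
        congr 1
        ring
    _ ≤ (R / r) ^ (-γ - α) * (1 + R) ^ (α - m) := by gcongr
    _ = _ := by rw [h3]

theorem inv_rpow_one_div_pow (d : ℕ) {β t : ℝ} (ht : 0 ≤ t) :
    ((t ^ (1 / β)) ^ d)⁻¹ = t ^ (-(d : ℝ) / β) := by
  rw [← Real.rpow_natCast, ← Real.rpow_mul ht, ← Real.rpow_neg ht]
  congr 1
  ring

/-- The exponents are additive in time, so the semigroup law follows from uniqueness of
characteristic functions, and the P_t may be built separately for each t. -/
theorem IsLevySemigroup.of_charFun_eq {ν : Measure (EuclideanSpace ℝ (Fin d))}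
    {b : EuclideanSpace ℝ (Fin d)} {P : ℝ → Measure (EuclideanSpace ℝ (Fin d))}
    (hP : ∀ t, 0 ≤ t → IsProbabilityMeasure (P t))
    (h : ∀ t, 0 ≤ t → ∀ ξ, charFun (P t) ξ = Complex.exp (-(t : ℂ) * levyExponent ν b ξ)) :
    IsLevySemigroup ν b P where
  isProbabilityMeasure := hP
  charFun_eq := h
  conv_eq s t hs ht := by
    have := hP s hs
    have := hP t ht
    have := hP (s + t) (add_nonneg hs ht)
    refine Measure.ext_of_charFun (funext fun ξ => ?_)
    rw [charFun_conv, h s hs, h t ht, h _ (add_nonneg hs ht), ← Complex.exp_add]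
    congr 1
    push_cast
    ring

theorem exists_isLevySemigroup_of_forall_pos {ν : Measure (EuclideanSpace ℝ (Fin d))}
    {b : EuclideanSpace ℝ (Fin d)}
    (h : ∀ t : ℝ, 0 < t → ∃ P : Measure (EuclideanSpace ℝ (Fin d)), IsProbabilityMeasure P ∧
      ∀ ξ, charFun P ξ = Complex.exp (-(t : ℂ) * levyExponent ν b ξ)) :
    ∃ P, IsLevySemigroup ν b P := by
  have h' : ∀ t : ℝ, ∃ P : Measure (EuclideanSpace ℝ (Fin d)), 0 ≤ t → IsProbabilityMeasure P ∧
      ∀ ξ, charFun P ξ = Complex.exp (-(t : ℂ) * levyExponent ν b ξ) := by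
    intro t
    rcases lt_trichotomy t 0 with ht | rfl | ht
    -- The value at negative times is arbitrary.
    · exact ⟨0, fun h0 => absurd ht h0.not_gt⟩
    · exact ⟨Measure.dirac 0, fun _ => ⟨inferInstance, fun ξ => by simp [charFun_dirac]⟩⟩
    · obtain ⟨P, hP⟩ := h t ht
      exact ⟨P, fun _ => hP⟩
  choose P hP using h'
  exact ⟨P, .of_charFun_eq (fun t ht => (hP t ht).1) (fun t ht => (hP t ht).2)⟩

theorem IsLevySemigroup.eq_of_charFun_eq {ν : Measure (EuclideanSpace ℝ (Fin d))}
    {b : EuclideanSpace ℝ (Fin d)} {P : ℝ → Measure (EuclideanSpace ℝ (Fin d))}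
    (hP : IsLevySemigroup ν b P) {t : ℝ} (ht : 0 ≤ t) {P' : Measure (EuclideanSpace ℝ (Fin d))}
    [IsProbabilityMeasure P']
    (h : ∀ ξ, charFun P' ξ = Complex.exp (-(t : ℂ) * levyExponent ν b ξ)) : P t = P' := by
  have := hP.isProbabilityMeasure t ht
  exact Measure.ext_of_charFun (funext fun ξ => by rw [hP.charFun_eq t ht, h])

end

/-! ### The main theorem -/

theorem mainTheorem4 (d : ℕ) (α m γ K : ℝ) (hα : α ∈ Set.Ioo (0 : ℝ) 2) (hm : 2 < m)
    (hγ : γ ∈ Set.Icc (1 : ℝ) d) (hK : 0 < K)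
    (μ : MeasureTheory.Measure (Metric.sphere (0 : EuclideanSpace ℝ (Fin d)) 1))
    [MeasureTheory.IsFiniteMeasure μ]
    (hμ : SphereNondegenerate μ) (hμγ : IsSphereDimMeasure (γ - 1) μ) :
    ∃ c c₁ c₂ c₃ : ℝ, 0 < c ∧ 0 < c₁ ∧ 0 < c₂ ∧ 0 < c₃ ∧
      ∀ Q : Metric.sphere (0 : EuclideanSpace ℝ (Fin d)) 1 → ℝ → ℝ,
        Measurable (Function.uncurry Q) → IsLayered α m K Q →
        ∀ b : EuclideanSpace ℝ (Fin d),
          (∃ P, IsLevySemigroup (polarMeasure μ Q) b P) ∧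
          ∀ P, IsLevySemigroup (polarMeasure μ Q) b P →
            ∃ p : ℝ → EuclideanSpace ℝ (Fin d) → ℝ,
              (∀ t, 0 < t → Continuous (p t) ∧ (∀ x, 0 ≤ p t x) ∧
                P t = MeasureTheory.volume.withDensity (fun x => ENNReal.ofReal (p t x))) ∧
              (∀ t, 0 < t → t ≤ 1 → ∀ x,
                p t (x + t • levyDrift (polarMeasure μ Q) b (t ^ (1 / α))) ≤
                  c * t ^ (-(d : ℝ) / α) * layeredBound α m γ α t x) ∧
              (∀ t, 1 < t → ∀ x,
                p t (x + t • levyDrift (polarMeasure μ Q) b (√t)) ≤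
                  c₁ * t ^ (-(d : ℝ) / 2) * (layeredBound α m γ 2 t x +
                    Real.exp (-c₂ * ‖x‖ / √t * Real.log (1 + c₃ * ‖x‖ / √t)))) := by
  obtain ⟨B, c, C, hB, hc, hC, H⟩ := exists_layered_density hα hm hγ.1 hK μ hμ hμγ
  have hα0 : 0 < α := hα.1
  have hαm : α ≤ m := by linarith [hα.2]
  have hγ0 : 0 ≤ γ := by linarith [hγ.1]
  obtain ⟨D, hD, hexp⟩ := exists_exp_neg_mul_log_le (N := γ + m) hc (by linarith)
  -- D is the cost of turning the exponential into a power and C that of the ball masses; the 1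
  -- covers the uniform bound on the density. c₃ = 1/2 comes from evaluating the decay at |x|/2.
  refine ⟨B * (1 + D + C), B * (1 + C), c, 1 / 2, by positivity, by positivity, hc, by norm_num,
    fun Q hQ hL b => ?_⟩
  have hscale : ∀ t : ℝ, 0 < t → ∃ r, 0 < r ∧ ((r ≤ 1 ∧ t = r ^ α) ∨ (1 < r ∧ t = r ^ 2)) ∧
      (t ≤ 1 → r = t ^ (1 / α)) ∧ (1 < t → r = √t) := by
    intro t ht
    rcases le_or_gt t 1 with h1 | h1
    · refine ⟨t ^ (1 / α), by positivity, .inl ⟨Real.rpow_le_one ht.le h1 (by positivity), ?_⟩,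
        fun _ => rfl, fun h => absurd h1 h.not_ge⟩
      rw [← Real.rpow_mul ht.le, one_div_mul_cancel hα0.ne', Real.rpow_one]
    · exact ⟨√t, by positivity, .inr ⟨Real.lt_sqrt_of_sq_lt (by simpa using h1),
        (Real.sq_sqrt ht.le).symm⟩, fun h => absurd h1 h.not_gt, fun _ => rfl⟩
  refine ⟨exists_isLevySemigroup_of_forall_pos fun t ht => ?_, fun P hP => ?_⟩
  · obtain ⟨r, hr, hrt, -⟩ := hscale t ht
    obtain ⟨P, p, h1, h2, -⟩ := H Q hQ hL b t r hr hrt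
    exact ⟨P, h1, h2⟩
  -- The semigroup P is arbitrary, but its characteristic function identifies P_t with the law
  -- constructed at scale r, whose density it inherits.
  have hdens : ∀ t : ℝ, ∃ p : EuclideanSpace ℝ (Fin d) → ℝ, 0 < t →
      (Continuous p ∧ (∀ x, 0 ≤ p x) ∧ P t = volume.withDensity (fun x => ENNReal.ofReal (p x))) ∧
      ∃ r, 0 < r ∧ (t ≤ 1 → r = t ^ (1 / α)) ∧ (1 < t → r = √t) ∧
        (r ≤ 1 ∨ 1 < t) ∧ (∀ x, p x ≤ B * (r ^ d)⁻¹) ∧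
        ∀ x, p (x + t • levyDrift (polarMeasure μ Q) b r) ≤ B * (r ^ d)⁻¹ *
          (Real.exp (-c * (‖x‖ / r) * Real.log (1 + ‖x‖ / 2 / r)) +
            r ^ γ * ballTail α m γ (t * C) r ‖x‖) := by
    intro t
    by_cases ht : 0 < t
    · obtain ⟨r, hr, hrt, hr1, hr2⟩ := hscale t ht
      obtain ⟨P', p, h1, h2, h3, h4, h5, h6, h7⟩ := H Q hQ hL b t r hr hrt
      refine ⟨p, fun _ => ⟨⟨h3, h4, (hP.eq_of_charFun_eq ht.le h2).trans h5⟩, r, hr, hr1, hr2,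
        hrt.imp And.left fun h => ?_, h6, h7⟩⟩
      rw [h.2]
      exact one_lt_pow₀ h.1 two_ne_zero
    · exact ⟨0, fun h => absurd h ht⟩
  choose p hp using hdens
  refine ⟨p, fun t ht => (hp t ht).1, fun t ht h1 x => ?_, fun t h1 x => ?_⟩
  · obtain ⟨-, r, hr, hr1, -, hr', hs, hd⟩ := hp t ht
    have hrt := hr1 h1
    have hr'' : r ≤ 1 := hr'.resolve_right h1.not_gt
    rw [← inv_rpow_one_div_pow d ht.le, ← hrt]
    have hA : 0 ≤ B * (r ^ d)⁻¹ := by positivity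
    -- The uniform bound handles x = 0 and the case where the minimum is 1.
    have hle : p t (x + t • levyDrift (polarMeasure μ Q) b r) ≤
        B * (r ^ d)⁻¹ * (1 + D + C) :=
      (hs _).trans (le_mul_of_one_le_right hA (by linarith))
    unfold layeredBound
    split_ifs with hx
    · linarith
    · have hR : 0 < ‖x‖ := norm_pos_iff.2 hx
      have hv : 0 ≤ ‖x‖ / r := by positivity
      have e1 := (hexp _ hv).trans (mul_le_mul_of_nonneg_left
        (one_add_div_rpow_neg_le hα0 hαm hγ0 ht hrt hr'' hR) hD.le)
      have e2 := rpow_mul_ballTail_le hα0 hαm hγ0 hC ht hrt hR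
      have e3 := hd x
      rw [div_right_comm] at e3
      set X := t ^ (1 + γ / α) * ‖x‖ ^ (-γ - α) * (1 + ‖x‖) ^ (α - m)
      have hX : 0 ≤ X := by positivity
      have e4 : p t (x + t • levyDrift (polarMeasure μ Q) b r) ≤
          B * (r ^ d)⁻¹ * ((1 + D + C) * X) :=
        e3.trans (mul_le_mul_of_nonneg_left (by linarith) hA)
      -- The minimum is one of its two entries, and a bound is available for each.
      rcases min_choice 1 X with h | h <;> rw [h] <;> linarith
  · have ht : 0 < t := one_pos.trans h1
    obtain ⟨-, r, hr, -, hr2, -, hs, hd⟩ := hp t ht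
    have hrs := hr2 h1
    have hrt : r = t ^ (1 / (2 : ℝ)) := by rw [hrs, Real.sqrt_eq_rpow]
    rw [← inv_rpow_one_div_pow d ht.le, ← hrt, ← hrs]
    have hA : 0 ≤ B * (r ^ d)⁻¹ := by positivity
    have e3 := hd x
    rw [show -c * (‖x‖ / r) * Real.log (1 + ‖x‖ / 2 / r) =
      -c * ‖x‖ / r * Real.log (1 + 1 / 2 * ‖x‖ / r) by
        rw [mul_div_assoc (-c), one_div_mul_eq_div]] at e3
    set E := Real.exp (-c * ‖x‖ / r * Real.log (1 + 1 / 2 * ‖x‖ / r))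
    have hE : 0 ≤ E := (Real.exp_pos _).le
    have hCE : 0 ≤ C * E := mul_nonneg hC hE
    have h1' : p t (x + t • levyDrift (polarMeasure μ Q) b r) ≤
        B * (r ^ d)⁻¹ * ((1 + C) * (1 + E)) :=
      (hs _).trans (le_mul_of_one_le_right hA (by linarith))
    unfold layeredBound
    split_ifs with hx
    · linarith
    · have hR : 0 < ‖x‖ := norm_pos_iff.2 hx
      have e2 := rpow_mul_ballTail_le hα0 hαm hγ0 hC ht hrt hR
      set X := t ^ (1 + γ / 2) * ‖x‖ ^ (-γ - α) * (1 + ‖x‖) ^ (α - m)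
      have hX : 0 ≤ X := by positivity
      have e4 : p t (x + t • levyDrift (polarMeasure μ Q) b r) ≤
          B * (r ^ d)⁻¹ * ((1 + C) * (X + E)) :=
        e3.trans (mul_le_mul_of_nonneg_left (by linarith) hA)
      rcases min_choice 1 X with h | h <;> rw [h] <;> linarith
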